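/- **Problem.** Let $T\ge 1$. An instance of generalized $\Psi$-aggregate $k$-supplier consists of a set $V=F\cup C$ of $n$ points ($F$ the facilities, $C$ the clients, not necessarily disjoint), functions $d_1,\dots,d_T:V\times V\to\mathbb R_{\ge 0}$ that are symmetric and satisfy the triangle inequality, client weights $w_1,\dots,w_T:C\to\mathbb R_{\ge 0}$, and an integer $k$ with $1\le k\le |F|$. For a set $S\subseteq F$ with $|S|=k$ put $$\mathrm{cost}_\infty(d_t;S)=\max_{j\in C} w_t(j)\,\min_{i\in S} d_t(j,i)\qquad(t=1,\dots,T)$$ (read as $0$ if $C=\emptyset$). The goal is to minimize $\Psi\big(\mathrm{cost}_\infty(d_1;S),\dots,\mathrm{cost}_\infty(d_T;S)\big)$ over all $S\subseteq F$ with $|S|=k$. The unweighted $\Psi$-aggregate $k$-supplier problem is the case in which all weights equal $1$. Here $\Psi:\mathbb R_{\ge 0}^T\to\mathbb R_{\ge 0}$ is a homogeneous aggregator: $\Psi(\lambda x)=\lambda\Psi(x)$ for all $\lambda\ge 0$, and $\Psi$ is nondecreasing in each coordinate. **Theorem.** For $T=2$ there is a $\mathrm{poly}(n)$-time $3$-approximation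 algorithm for generalized $\Psi$-aggregate $k$-supplier for every homogeneous aggregator $\Psi$. Precisely, there are one program for the real RAM (unit-cost arithmetic $+,-,\times$ and comparisons on reals, index arithmetic $+,-$ and comparisons on natural numbers, real constants $0$ and $1$ only, and unit-cost access to the values of $\Psi$ through an oracle) and one polynomial $q$ such that, for every homogeneous aggregator $\Psi:\mathbb R_{\ge0}^2\to\mathbb R_{\ge0}$ and every instance with $T=2$ on $n$ points, the program halts after at most $q(n)$ steps and outputs a set $S\subseteq F$ with $|S|=k$ such that $$\Psi\big(\mathrm{cost}_\infty(d_1;S),\mathrm{cost}_\infty(d_2;S)\big)\le 3\,\Psi\big(\mathrm{cost}_\infty(d_1;S'),\mathrm{cost}_\infty(d_2;S')\big)\quad\text{for all } S'\subseteq F,\ |S'|=k.$$ -/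

import Mathlib

open scoped NNReal

/-! ## A real RAM with a value oracle

Programs are finite `while`-programs. Memory consists of two-dimensional arrays of natural numbers
(used for indices and flags) and two-dimensional arrays of real numbers, all randomly accessible
through computed indices; a scalar variable is the entry `(0, 0)` of an array. Natural numbers
support addition, truncated subtraction and comparison, real numbers support addition, subtraction,
multiplication and comparison; the only real constants are `0` and `1`, and there is no rounding.
A value oracle `(ℕ → ℝ) → ℝ` can be queried on the column `0` of a real array.
Every operation, memory access, comparison and oracle query costs one unit. -/

namespace RealRAM

/-- The contents of memory: `nat a i j` is entry `(i, j)` of the natural-number array `a`, `real a i j` that of the real array `a`. -/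
structure State where
  nat : ℕ → ℕ → ℕ → ℕ
  real : ℕ → ℕ → ℕ → ℝ

/-- Overwrite one entry of an array of naturals. -/
def State.setNat (s : State) (a i j v : ℕ) : State :=
  { s with nat := fun a' i' j' => if a' = a ∧ i' = i ∧ j' = j then v else s.nat a' i' j' }

/-- Overwrite one entry of an array of reals. -/
noncomputable def State.setReal (s : State) (a i j : ℕ) (v : ℝ) : State :=
  { s with real := fun a' i' j' => if a' = a ∧ i' = i ∧ j' = j then v else s.real a' i' j' }

/-- Expressions for natural numbers. -/
inductive NExpr where
  | const (c : ℕ)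
  | get (a : ℕ) (i j : NExpr)
  | add (x y : NExpr)
  | sub (x y : NExpr)

def NExpr.eval (s : State) : NExpr → ℕ
  | .const c => c
  | .get a i j => s.nat a (i.eval s) (j.eval s)
  | .add x y => x.eval s + y.eval s
  | .sub x y => x.eval s - y.eval s

/-- The number of operations needed to evaluate an expression. -/
def NExpr.cost : NExpr → ℕ
  | .const _ => 1
  | .get _ i j => i.cost + j.cost + 1
  | .add x y => x.cost + y.cost + 1
  | .sub x y => x.cost + y.cost + 1

/-- Expressions for real numbers. `query a` asks the oracle for its value at
the vector stored in column `0` of the real array `a`. -/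
inductive RExpr where
  | zero
  | one
  | get (a : ℕ) (i j : NExpr)
  | add (x y : RExpr)
  | sub (x y : RExpr)
  | mul (x y : RExpr)
  | query (a : ℕ)

noncomputable def RExpr.eval (O : (ℕ → ℝ) → ℝ) (s : State) : RExpr → ℝ
  | .zero => 0
  | .one => 1
  | .get a i j => s.real a (i.eval s) (j.eval s)
  | .add x y => x.eval O s + y.eval O s
  | .sub x y => x.eval O s - y.eval O s
  | .mul x y => x.eval O s * y.eval O s
  | .query a => O (fun i => s.real a i 0)

def RExpr.cost : RExpr → ℕ
  | .zero => 1
  | .one => 1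
  | .get _ i j => i.cost + j.cost + 1
  | .add x y => x.cost + y.cost + 1
  | .sub x y => x.cost + y.cost + 1
  | .mul x y => x.cost + y.cost + 1
  | .query _ => 1

/-- Conditions. -/
inductive Guard where
  | natLe (x y : NExpr)
  | realLe (x y : RExpr)
  | neg (b : Guard)
  | conj (b c : Guard)

def Guard.Holds (O : (ℕ → ℝ) → ℝ) (s : State) : Guard → Prop
  | .natLe x y => x.eval s ≤ y.eval s
  | .realLe x y => x.eval O s ≤ y.eval O s
  | .neg b => ¬ b.Holds O s
  | .conj b c => b.Holds O s ∧ c.Holds O s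

def Guard.cost : Guard → ℕ
  | .natLe x y => x.cost + y.cost + 1
  | .realLe x y => x.cost + y.cost + 1
  | .neg b => b.cost + 1
  | .conj b c => b.cost + c.cost + 1

/-- Programs. -/
inductive Prog where
  | skip
  | setNat (a : ℕ) (i j e : NExpr)
  | setReal (a : ℕ) (i j : NExpr) (e : RExpr)
  | seq (p q : Prog)
  | ite (b : Guard) (p q : Prog)
  | whileDo (b : Guard) (p : Prog)

/-- `Exec O p s s' t`: with oracle `O`, the program `p` started in memory state `s` halts
in memory state `s'` after exactly `t` steps. -/
inductive Exec (O : (ℕ → ℝ) → ℝ) : Prog → State → State → ℕ → Prop where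
  | skip (s : State) : Exec O .skip s s 1
  | setNat (a : ℕ) (i j e : NExpr) (s : State) :
      Exec O (.setNat a i j e) s (s.setNat a (i.eval s) (j.eval s) (e.eval s))
        (i.cost + j.cost + e.cost + 1)
  | setReal (a : ℕ) (i j : NExpr) (e : RExpr) (s : State) :
      Exec O (.setReal a i j e) s (s.setReal a (i.eval s) (j.eval s) (e.eval O s))
        (i.cost + j.cost + e.cost + 1)
  | seq {p q : Prog} {s s₁ s₂ : State} {t₁ t₂ : ℕ} :
      Exec O p s s₁ t₁ → Exec O q s₁ s₂ t₂ → Exec O (.seq p q) s s₂ (t₁ + t₂)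
  | ite_true {b : Guard} {p q : Prog} {s s₁ : State} {t : ℕ} :
      b.Holds O s → Exec O p s s₁ t → Exec O (.ite b p q) s s₁ (b.cost + t)
  | ite_false {b : Guard} {p q : Prog} {s s₁ : State} {t : ℕ} :
      ¬ b.Holds O s → Exec O q s s₁ t → Exec O (.ite b p q) s s₁ (b.cost + t)
  | while_true {b : Guard} {p : Prog} {s s₁ s₂ : State} {t₁ t₂ : ℕ} :
      b.Holds O s → Exec O p s s₁ t₁ → Exec O (.whileDo b p) s₁ s₂ t₂ →
        Exec O (.whileDo b p) s s₂ (b.cost + t₁ + t₂)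
  | while_false {b : Guard} {p : Prog} {s : State} :
      ¬ b.Holds O s → Exec O (.whileDo b p) s s b.cost

/-- The machine is deterministic: the final state and the number of steps are unique. -/
theorem Exec.deterministic {O : (ℕ → ℝ) → ℝ} {p : Prog} {s s₁ s₂ : State} {t₁ t₂ : ℕ}
    (h₁ : Exec O p s s₁ t₁) (h₂ : Exec O p s s₂ t₂) : s₁ = s₂ ∧ t₁ = t₂ := by
  induction h₁ generalizing s₂ t₂ with
  | skip s => cases h₂; exact ⟨rfl, rfl⟩
  | setNat a i j e s => cases h₂; exact ⟨rfl, rfl⟩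
  | setReal a i j e s => cases h₂; exact ⟨rfl, rfl⟩
  | seq _ _ ih ih' =>
    cases h₂ with
    | seq g g' =>
      obtain ⟨rfl, rfl⟩ := ih g
      obtain ⟨rfl, rfl⟩ := ih' g'
      exact ⟨rfl, rfl⟩
  | ite_true hb _ ih =>
    cases h₂ with
    | ite_true _ g => obtain ⟨rfl, rfl⟩ := ih g; exact ⟨rfl, rfl⟩
    | ite_false hb' _ => exact absurd hb hb'
  | ite_false hb _ ih =>
    cases h₂ with
    | ite_true hb' _ => exact absurd hb' hb
    | ite_false _ g => obtain ⟨rfl, rfl⟩ := ih g; exact ⟨rfl, rfl⟩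
  | while_true hb _ _ ih ih' =>
    cases h₂ with
    | while_true _ g g' =>
      obtain ⟨rfl, rfl⟩ := ih g
      obtain ⟨rfl, rfl⟩ := ih' g'
      exact ⟨rfl, rfl⟩
    | while_false hb' => exact absurd hb hb'
  | while_false hb =>
    cases h₂ with
    | while_true hb' _ _ => exact absurd hb' hb
    | while_false _ => exact ⟨rfl, rfl⟩

end RealRAM

/-! ## Generalized aggregate `k`-supplier -/

namespace AggregateSupplier

/-- A homogeneous aggregator of `T` nonnegative costs: homogeneous of degree one, and
coordinatewise nondecreasing. -/
structure IsHomogeneousAggregator {T : ℕ} (Ψ : (Fin T → ℝ≥0) → ℝ≥0) : Prop where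
  homogeneous : ∀ (c : ℝ≥0) (x : Fin T → ℝ≥0), Ψ (c • x) = c * Ψ x
  monotone : Monotone Ψ

/-- An instance with `T` distance functions on a set of `n` points. The distance functions are
symmetric and satisfy the triangle inequality. The unweighted problem is the case `w = 1`. -/
structure SupplierInstance (T n : ℕ) where
  /-- the facilities -/
  F : Finset (Fin n)
  /-- the clients -/
  C : Finset (Fin n)
  cover : F ∪ C = Finset.univ
  d : Fin T → Fin n → Fin n → ℝ≥0
  symm : ∀ t u v, d t u v = d t v u
  triangle : ∀ t u v x, d t u x ≤ d t u v + d t v x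
  /-- the weights of the clients (values outside `C` are never used in the costs) -/
  w : Fin T → Fin n → ℝ≥0
  k : ℕ
  one_le_k : 1 ≤ k
  k_le_card : k ≤ F.card

namespace SupplierInstance

variable {T n : ℕ}

/-- A solution opens exactly `k` facilities. -/
def IsSolution (I : SupplierInstance T n) (S : Finset (Fin n)) : Prop :=
  S ⊆ I.F ∧ S.card = I.k

open Classical in
/-- `d_t(j, S) = min_{i ∈ S} d_t(j, i)`; solutions are nonempty, so the value at `S = ∅`
is irrelevant. -/
noncomputable def distTo (I : SupplierInstance T n) (t : Fin T) (j : Fin n)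
    (S : Finset (Fin n)) : ℝ≥0 :=
  if h : S.Nonempty then S.inf' h (I.d t j) else 0

/-- `max_{j ∈ C} w_t(j) · d_t(j, S)`, which is `0` if there is no client. -/
noncomputable def cost (I : SupplierInstance T n) (S : Finset (Fin n)) (t : Fin T) : ℝ≥0 :=
  I.C.sup fun j => I.w t j * I.distTo t j S

/-- `S` is a solution whose objective value is at most `α` times that of every solution. -/
def IsApproxSolution (I : SupplierInstance T n) (Ψ : (Fin T → ℝ≥0) → ℝ≥0) (α : ℝ≥0)
    (S : Finset (Fin n)) : Prop :=
  I.IsSolution S ∧ ∀ S' : Finset (Fin n), I.IsSolution S' → Ψ (I.cost S) ≤ α * Ψ (I.cost S')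

open Classical in
/-- The initial memory: the natural arrays `0, 1` hold `n` and `k`, arrays `2, 3` hold
the indicators of `F` and `C`; the real arrays `2 t` and `2 t + 1` hold `d_t` and `w_t`.
Everything else is `0`. -/
noncomputable def initialState (I : SupplierInstance T n) : RealRAM.State where
  nat a i j :=
    if j ≠ 0 then 0
    else if a = 0 ∧ i = 0 then n
    else if a = 1 ∧ i = 0 then I.k
    else if a = 2 ∧ (∃ v ∈ I.F, (v : ℕ) = i) then 1
    else if a = 3 ∧ (∃ v ∈ I.C, (v : ℕ) = i) then 1
    else 0
  real a i j :=
    if hT : a / 2 < T then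
      if hi : i < n then
        if a % 2 = 0 then
          if hj : j < n then I.d ⟨a / 2, hT⟩ ⟨i, hi⟩ ⟨j, hj⟩ else 0
        else if j = 0 then I.w ⟨a / 2, hT⟩ ⟨i, hi⟩ else 0
      else 0
    else 0

end SupplierInstance

/-- The value oracle for the aggregator `Ψ`: it reads the first `T` entries of the query. -/
noncomputable def valueOracle {T : ℕ} (Ψ : (Fin T → ℝ≥0) → ℝ≥0) (x : ℕ → ℝ) : ℝ :=
  Ψ fun t => (x t).toNNReal

/-- The set of points flagged by a nonzero entry in the natural array `4`. -/
def outputSet (n : ℕ) (s : RealRAM.State) : Finset (Fin n) :=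
  Finset.univ.filter fun v => s.nat 4 v 0 ≠ 0

end AggregateSupplier

/-! If there are clients, each cost of an optimal solution has the form `w_t(j) * d_t(j, i)`, so
four nested loops over points run through at most `n ^ 4` guesses `r = (r₁, r₂)`, and one of them is
the optimal cost vector. For a fixed guess, the ball of client `j` in metric `t` consists of the
facilities `i` with `w_t(j) * d_t(j, i) ≤ r_t`. Scanning the clients by descending weight yields in
each metric a family of clients with pairwise disjoint balls, such that every other client's ball
meets the ball of a chosen client of at least the same weight. Any facility in the chosen ball then
serves the other client within `3 * r_t`: go through a common facility of the two balls and use the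
larger weight for the last two legs (`MetricState.three_mul`).

It remains to hit all chosen balls with at most `k` facilities. Let `A` and `B` be the families
chosen in the two metrics. A facility lies in at most one ball of each family, so the problem is to
find a maximum matching in the bipartite graph of intersecting balls: one facility for every matched
pair and one for every unmatched client. This opens at most as many facilities as `B` and the
unmatched part of `A` have members together. Conversely, a feasible solution within the guess hits
all these balls, so it has at least that many facilities (`AuctionInv.card_le`). Hence an attainable
guess always passes the test (`solve_complete`), and any guess that passes yields a solution of cost
at most `3 * r` in both metrics (`solve_sound`).

The matching comes from an auction with integer prices: a free client of `A` takes its cheapest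
neighbour, evicts the previous owner and raises the price by one, up to the limit `n + 2`. The final
prices certify optimality without augmenting paths, because some level between `1` and `n + 1` is
the price of no vertex and separates the vertices of an independent set of the right size. The sum
of the prices is a potential that bounds the number of rounds.

The search keeps a solution for the accepted guess of least value `Ψ r`. Monotonicity and
homogeneity give `Ψ(cost) ≤ Ψ(3 r) = 3 Ψ(r)`, and `Ψ r` is at most the optimum.

On the machine side, the algorithm is written with counted loops only. Such programs have a total
semantics `run` and a time polynomial defined by recursion on the syntax (`LoopProg.exec_run`), so
correctness is proved for `run` alone. -/

namespace RealRAM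

/-! ### Programs with counted loops: semantics, write sets and running time -/

@[simp] theorem State.setNat_nat (s : State) (a i j v a' i' j' : ℕ) :
    (s.setNat a i j v).nat a' i' j' = if a' = a ∧ i' = i ∧ j' = j then v else s.nat a' i' j' := rfl

@[simp] theorem State.setNat_real (s : State) (a i j v : ℕ) : (s.setNat a i j v).real = s.real := rfl

@[simp] theorem State.setReal_nat (s : State) (a i j : ℕ) (v : ℝ) :
    (s.setReal a i j v).nat = s.nat := rfl

@[simp] theorem State.setReal_real (s : State) (a i j : ℕ) (v : ℝ) (a' i' j' : ℕ) :
    (s.setReal a i j v).real a' i' j' =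
      if a' = a ∧ i' = i ∧ j' = j then v else s.real a' i' j' := rfl

/-- Programs all of whose loops are counted: `loop v c p` runs `p` for the values
`0, …, n + c - 1` of the counter `v`, where `n` is the content of the natural array `0`. -/
inductive LoopProg where
  | skip
  | setNat (a : ℕ) (i j e : NExpr)
  | setReal (a : ℕ) (i j : NExpr) (e : RExpr)
  | seq (p q : LoopProg)
  | ite (b : Guard) (p q : LoopProg)
  | loop (v c : ℕ) (p : LoopProg)

namespace LoopProg

/-- The guard of a counted loop. -/
def loopGuard (v c : ℕ) : Guard :=
  .neg (.natLe (.add (.get 0 (.const 0) (.const 0)) (.const c)) (.get v (.const 0) (.const 0)))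

/-- Translation to `while`-programs. -/
def compile : LoopProg → Prog
  | skip => .skip
  | setNat a i j e => .setNat a i j e
  | setReal a i j e => .setReal a i j e
  | seq p q => .seq p.compile q.compile
  | ite b p q => .ite b p.compile q.compile
  | loop v c p =>
    .seq (.setNat v (.const 0) (.const 0) (.const 0))
      (.whileDo (loopGuard v c)
        (.seq p.compile
          (.setNat v (.const 0) (.const 0) (.add (.get v (.const 0) (.const 0)) (.const 1)))))

/-- The state after `i` rounds of a counted loop with body `f`. -/
def iter (v : ℕ) (f : State → State) (s : State) : ℕ → State
  | 0 => s
  | i + 1 => f ((iter v f s i).setNat v 0 0 i)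

open Classical in
/-- The final state of a counted program. -/
noncomputable def run (O : (ℕ → ℝ) → ℝ) : LoopProg → State → State
  | skip, s => s
  | setNat a i j e, s => s.setNat a (i.eval s) (j.eval s) (e.eval s)
  | setReal a i j e, s => s.setReal a (i.eval s) (j.eval s) (e.eval O s)
  | seq p q, s => q.run O (p.run O s)
  | ite b p q, s => if b.Holds O s then p.run O s else q.run O s
  | loop v c p, s =>
    (iter v (p.run O) s (s.nat 0 0 0 + c)).setNat v 0 0 (s.nat 0 0 0 + c)

theorem run_seq (O : (ℕ → ℝ) → ℝ) (p q : LoopProg) (s : State) :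
    (seq p q).run O s = q.run O (p.run O s) := by
  rw [run]

/-- The arrays of naturals that a program may write to. -/
def natWrites : LoopProg → List ℕ
  | skip => []
  | setNat a _ _ _ => [a]
  | setReal _ _ _ _ => []
  | seq p q => p.natWrites ++ q.natWrites
  | ite _ p q => p.natWrites ++ q.natWrites
  | loop v _ p => v :: p.natWrites

/-- The arrays of reals that a program may write to. -/
def realWrites : LoopProg → List ℕ
  | skip => []
  | setNat _ _ _ _ => []
  | setReal a _ _ _ => [a]
  | seq p q => p.realWrites ++ q.realWrites
  | ite _ p q => p.realWrites ++ q.realWrites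
  | loop _ _ p => p.realWrites

/-- No program part overwrites the size `n` or the counter of an enclosing loop. -/
def WellFormed : LoopProg → Prop
  | skip => True
  | setNat _ _ _ _ => True
  | setReal _ _ _ _ => True
  | seq p q => p.WellFormed ∧ q.WellFormed
  | ite _ p q => p.WellFormed ∧ q.WellFormed
  | loop v _ p => p.WellFormed ∧ v ≠ 0 ∧ v ∉ p.natWrites ∧ 0 ∉ p.natWrites

/-- A bound for the running time as a polynomial in `n`. -/
noncomputable def time : LoopProg → Polynomial ℕ
  | skip => 1
  | setNat _ i j e => .C (i.cost + j.cost + e.cost + 1)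
  | setReal _ i j e => .C (i.cost + j.cost + e.cost + 1)
  | seq p q => p.time + q.time
  | ite b p q => .C b.cost + p.time + q.time
  | loop v c p => 4 + (.X + .C c) * (.C (loopGuard v c).cost + p.time + 8) + .C (loopGuard v c).cost

/-- Non-interference is read off the syntax, so that an array computed by one phase survives the
later ones by a mere check of array numbers. -/
theorem run_nat {O : (ℕ → ℝ) → ℝ} {p : LoopProg} {a : ℕ} (h : a ∉ p.natWrites) (s : State) :
    (p.run O s).nat a = s.nat a := by
  induction p generalizing s with
  | skip => rfl
  | setNat b i j e =>
    funext i' j'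
    simp only [natWrites, List.mem_singleton] at h
    simp [run, h]
  | setReal b i j e => rfl
  | seq p q ihp ihq =>
    simp only [natWrites, List.mem_append, not_or] at h
    rw [run, ihq h.2, ihp h.1]
  | ite b p q ihp ihq =>
    simp only [natWrites, List.mem_append, not_or] at h
    rw [run]
    split_ifs
    · exact ihp h.1 s
    · exact ihq h.2 s
  | loop v c p ih =>
    simp only [natWrites, List.mem_cons, not_or] at h
    have hset : ∀ (s : State) (x : ℕ), (s.setNat v 0 0 x).nat a = s.nat a := by
      intro s x
      funext i j
      simp [h.1]
    have hiter : ∀ i, (iter v (p.run O) s i).nat a = s.nat a := by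
      intro i
      induction i with
      | zero => rfl
      | succ i hi => rw [iter, ih h.2, hset, hi]
    rw [run, hset, hiter]

theorem run_real {O : (ℕ → ℝ) → ℝ} {p : LoopProg} {a : ℕ} (h : a ∉ p.realWrites) (s : State) :
    (p.run O s).real a = s.real a := by
  induction p generalizing s with
  | skip => rfl
  | setNat b i j e => rfl
  | setReal b i j e =>
    funext i' j'
    simp only [realWrites, List.mem_singleton] at h
    simp [run, h]
  | seq p q ihp ihq =>
    simp only [realWrites, List.mem_append, not_or] at h
    rw [run, ihq h.2, ihp h.1]
  | ite b p q ihp ihq =>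
    simp only [realWrites, List.mem_append, not_or] at h
    rw [run]
    split_ifs
    · exact ihp h.1 s
    · exact ihq h.2 s
  | loop v c p ih =>
    have hiter : ∀ i, (iter v (p.run O) s i).real a = s.real a := by
      intro i
      induction i with
      | zero => rfl
      | succ i hi => rw [iter, ih h, State.setNat_real, hi]
    rw [run, State.setNat_real, hiter]

/-- A counted program computes `run` within time `time`. -/
theorem exec_run (O : (ℕ → ℝ) → ℝ) {p : LoopProg} (hp : p.WellFormed) (h0 : 0 ∉ p.natWrites)
    (s : State) : ∃ t, Exec O p.compile s (p.run O s) t ∧ t ≤ p.time.eval (s.nat 0 0 0) := by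
  induction p generalizing s with
  | skip => exact ⟨1, .skip s, by simp [time]⟩
  | setNat a i j e => exact ⟨_, .setNat a i j e s, by simp [time]⟩
  | setReal a i j e => exact ⟨_, .setReal a i j e s, by simp [time]⟩
  | seq p q ihp ihq =>
    simp only [natWrites, List.mem_append, not_or] at h0
    obtain ⟨t₁, e₁, b₁⟩ := ihp hp.1 h0.1 s
    obtain ⟨t₂, e₂, b₂⟩ := ihq hp.2 h0.2 (p.run O s)
    rw [run_nat h0.1] at b₂
    refine ⟨_, .seq e₁ e₂, ?_⟩
    simp only [time, Polynomial.eval_add]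
    omega
  | ite b p q ihp ihq =>
    simp only [natWrites, List.mem_append, not_or] at h0
    obtain ⟨t₁, e₁, b₁⟩ := ihp hp.1 h0.1 s
    obtain ⟨t₂, e₂, b₂⟩ := ihq hp.2 h0.2 s
    by_cases hb : b.Holds O s
    · refine ⟨_, by rw [run, if_pos hb]; exact .ite_true hb e₁, ?_⟩
      simp only [time, Polynomial.eval_add, Polynomial.eval_C]
      omega
    · refine ⟨_, by rw [run, if_neg hb]; exact .ite_false hb e₂, ?_⟩
      simp only [time, Polynomial.eval_add, Polynomial.eval_C]
      omega
  | loop v c p ih =>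
    obtain ⟨hwf, hv0, hvp, h0p⟩ := hp
    set n := s.nat 0 0 0 with hn
    obtain ⟨g, hg⟩ : ∃ g, (loopGuard v c).cost = g := ⟨_, rfl⟩
    have hiter : ∀ i, (iter v (p.run O) s i).nat 0 0 0 = n := by
      intro i
      induction i with
      | zero => rfl
      | succ i hi => rw [iter, run_nat h0p]; simp [hv0.symm, hi]
    have hsv : ∀ i, (p.run O ((iter v (p.run O) s i).setNat v 0 0 i)).nat v 0 0 = i := by
      intro i
      rw [run_nat hvp]
      simp
    -- Induction on the number `m` of rounds still to come, because `Exec` unfolds a loop from its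
    -- first round.
    have key : ∀ m i, i + m = n + c → ∃ t,
        Exec O (.whileDo (loopGuard v c)
          (.seq p.compile
            (.setNat v (.const 0) (.const 0) (.add (.get v (.const 0) (.const 0)) (.const 1)))))
          ((iter v (p.run O) s i).setNat v 0 0 i)
          ((iter v (p.run O) s (n + c)).setNat v 0 0 (n + c)) t ∧
        t ≤ m * (g + p.time.eval n + 8) + g := by
      intro m
      induction m with
      | zero =>
        intro i hi
        obtain rfl : i = n + c := by omega
        refine ⟨g, hg ▸ .while_false ?_, by omega⟩
        simp [loopGuard, Guard.Holds, NExpr.eval, hiter, hv0.symm]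
      | succ m hm =>
        intro i hi
        obtain ⟨t, e, b⟩ := hm (i + 1) (by omega)
        obtain ⟨t₁, e₁, b₁⟩ := ih hwf h0p ((iter v (p.run O) s i).setNat v 0 0 i)
        have hn' : ((iter v (p.run O) s i).setNat v 0 0 i).nat 0 0 0 = n := by
          simp [hv0.symm, hiter]
        rw [hn'] at b₁
        have e₂ := Exec.setNat (O := O) v (.const 0) (.const 0)
          (.add (.get v (.const 0) (.const 0)) (.const 1))
          (p.run O ((iter v (p.run O) s i).setNat v 0 0 i))
        simp only [NExpr.eval, hsv, NExpr.cost] at e₂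
        refine ⟨_, .while_true ?_ (.seq e₁ e₂) e, ?_⟩
        · simp [loopGuard, Guard.Holds, NExpr.eval, hiter, hv0.symm]
          omega
        -- The constant `8` is the cost of incrementing the counter.
        · have : (m + 1) * (g + p.time.eval n + 8) =
              m * (g + p.time.eval n + 8) + (g + p.time.eval n + 8) := by ring
          rw [hg]
          change g + (t₁ + 8) + t ≤ _
          omega
    obtain ⟨t, e, b⟩ := key (n + c) 0 (by omega)
    have e₀ := Exec.setNat (O := O) v (.const 0) (.const 0) (.const 0) s
    refine ⟨_, .seq e₀ e, ?_⟩
    simp only [time, Polynomial.eval_add, Polynomial.eval_mul, Polynomial.eval_C,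
      Polynomial.eval_X, NExpr.cost, Polynomial.eval_ofNat, hg]
    omega

/-- Agreement of two states outside the arrays that `p` may write to. -/
def Frame (p : LoopProg) (s s' : State) : Prop :=
  (∀ a, a ∉ p.natWrites → s'.nat a = s.nat a) ∧ ∀ a, a ∉ p.realWrites → s'.real a = s.real a

theorem frame_run (O : (ℕ → ℝ) → ℝ) (p : LoopProg) (s : State) : p.Frame s (p.run O s) :=
  ⟨fun _ h => run_nat h s, fun _ h => run_real h s⟩

/-- Induction along a counted loop. -/
theorem loop_induction {O : (ℕ → ℝ) → ℝ} {v c : ℕ} {p : LoopProg} {s₀ : State}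
    (P : ℕ → State → Prop) (hP : ∀ i s x, P i s → P i (s.setNat v 0 0 x)) (zero : P 0 s₀)
    (step : ∀ i < s₀.nat 0 0 0 + c, ∀ s, (loop v c p).Frame s₀ s → s.nat v 0 0 = i → P i s →
      P (i + 1) (p.run O s)) :
    P (s₀.nat 0 0 0 + c) ((loop v c p).run O s₀) := by
  have hset : ∀ (s : State) (x : ℕ), (loop v c p).Frame s₀ s →
      (loop v c p).Frame s₀ (s.setNat v 0 0 x) := by
    intro s x h
    refine ⟨fun a ha => ?_, h.2⟩
    rw [← h.1 a ha]
    funext i j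
    simp only [natWrites, List.mem_cons, not_or] at ha
    simp [ha.1]
  -- The frame is carried along with `P`, since `step` may rely on the arrays that the loop never
  -- writes to.
  have key : ∀ i ≤ s₀.nat 0 0 0 + c,
      (loop v c p).Frame s₀ (iter v (p.run O) s₀ i) ∧ P i (iter v (p.run O) s₀ i) := by
    intro i
    induction i with
    | zero => exact fun _ => ⟨⟨fun _ _ => rfl, fun _ _ => rfl⟩, zero⟩
    | succ i hi =>
      intro hle
      obtain ⟨hf, hp⟩ := hi (by omega)
      have hf' := hset _ i hf
      refine ⟨⟨fun a ha => ?_, fun a ha => ?_⟩, ?_⟩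
      · rw [← hf'.1 a ha, iter]
        simp only [natWrites, List.mem_cons, not_or] at ha
        exact run_nat ha.2 _
      · rw [← hf'.2 a ha, iter]
        exact run_real (p := p) ha _
      · exact step i (by omega) _ hf' (by simp) (hP _ _ _ hp)
  exact hP _ _ _ (key _ le_rfl).2

end LoopProg

end RealRAM

namespace AggregateSupplier

/-! ### Greedy selection -/

/-- Invariant of the greedy selection of pairwise non-meeting clients by descending weight. -/
structure GreedyInv (n : ℕ) (C : ℕ → Prop) (w : ℕ → ℝ) (M : ℕ → ℕ → Prop) (sel cov : ℕ → ℕ) :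
    Prop where
  client : ∀ a < n, sel a ≠ 0 → C a ∧ cov a ≠ 0
  indep : ∀ a < n, ∀ b < n, sel a ≠ 0 → sel b ≠ 0 → M a b → a = b
  marked : ∀ a < n, ∀ b < n, sel a ≠ 0 → M a b → cov b ≠ 0
  cover : ∀ b < n, C b → cov b ≠ 0 → ∃ a < n, sel a ≠ 0 ∧ w b ≤ w a ∧ (b = a ∨ M a b)

/-- An uncovered client meets no selected one, by `marked`, so independence persists. Clients that
become covered now were candidates for the maximum, so their weights are at most that of `m`. The
client `m` is covered explicitly: if its ball is empty, it does not even meet itself. -/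
theorem GreedyInv.step {n : ℕ} {C : ℕ → Prop} {w : ℕ → ℝ} {M : ℕ → ℕ → Prop}
    {sel cov sel' cov' : ℕ → ℕ} (h : GreedyInv n C w M sel cov) (hM : ∀ a b, M a b → M b a)
    {m : ℕ} (hm : m < n) (hC : C m) (hcov : cov m = 0)
    (hmax : ∀ b < n, C b → cov b = 0 → w b ≤ w m)
    (hsel' : ∀ b < n, sel' b ≠ 0 ↔ b = m ∨ sel b ≠ 0)
    (hcov' : ∀ b < n, cov' b ≠ 0 ↔ (b = m ∨ M m b) ∨ cov b ≠ 0) :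
    GreedyInv n C w M sel' cov' := by
  obtain ⟨h1, h2, h3, h4⟩ := h
  refine ⟨?_, ?_, ?_, ?_⟩
  · intro a ha hs
    rw [hcov' a ha]
    rcases (hsel' a ha).1 hs with rfl | hs
    · exact ⟨hC, .inl (.inl rfl)⟩
    · exact ⟨(h1 a ha hs).1, .inr (h1 a ha hs).2⟩
  · intro a ha b hb hsa hsb hab
    rcases (hsel' a ha).1 hsa with rfl | hsa
    · rcases (hsel' b hb).1 hsb with rfl | hsb
      · rfl
      · exact absurd hcov (h3 b hb a ha hsb (hM _ _ hab))
    · rcases (hsel' b hb).1 hsb with rfl | hsb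
      · exact absurd hcov (h3 a ha b hb hsa hab)
      · exact h2 a ha b hb hsa hsb hab
  · intro a ha b hb hsa hab
    rw [hcov' b hb]
    rcases (hsel' a ha).1 hsa with rfl | hsa
    · exact .inl (.inr hab)
    · exact .inr (h3 a ha b hb hsa hab)
  · intro b hb hCb hcb
    by_cases hc : cov b = 0
    · refine ⟨m, hm, (hsel' m hm).2 (.inl rfl), hmax b hb hCb hc, ?_⟩
      rcases (hcov' b hb).1 hcb with h | h
      · exact h
      · exact absurd hc h
    · obtain ⟨a, ha, hs, hw, hd⟩ := h4 b hb hCb hc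
      exact ⟨a, ha, (hsel' a ha).2 (.inr hs), hw, hd⟩

/-! ### Bipartite matching by auction -/

/-- Invariant of the auction: `m₁ c = d + 1` and `m₂ d = c + 1` express that `c` and `d` are
matched, the entry `0` that a vertex is free. -/
structure AuctionInv (n : ℕ) (G : ℕ → ℕ → Prop) (price m₁ m₂ : ℕ → ℕ) : Prop where
  mate_iff : ∀ c < n, ∀ d < n, m₁ c = d + 1 ↔ m₂ d = c + 1
  left_le : ∀ c < n, m₁ c ≤ n
  right_le : ∀ d < n, m₂ d ≤ n
  edge : ∀ c < n, ∀ d < n, m₂ d = c + 1 → G c d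
  price_le : ∀ d < n, price d ≤ n + 2
  price_free : ∀ d < n, m₂ d = 0 → price d = 0
  slack : ∀ c < n, ∀ d < n, ∀ d' < n, m₂ d = c + 1 → G c d' → price d ≤ price d' + 1

/-- The new owner takes a cheapest neighbour, so after the increment it overpays by at most one. For
the other matched pairs, rising prices only relax `slack`. -/
theorem AuctionInv.bid {n : ℕ} {G : ℕ → ℕ → Prop} {price m₁ m₂ price' m₁' m₂' : ℕ → ℕ}
    (h : AuctionInv n G price m₁ m₂) {c d : ℕ} (hc : c < n) (hd : d < n) (hfree : m₁ c = 0)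
    (hG : G c d) (hp : price d < n + 2) (hmin : ∀ d' < n, G c d' → price d ≤ price d')
    (hprice' : ∀ x < n, price' x = if x = d then price d + 1 else price x)
    (hm₂' : ∀ x < n, m₂' x = if x = d then c + 1 else m₂ x)
    (hm₁' : ∀ x < n, m₁' x = if x = c then d + 1 else if x + 1 = m₂ d then 0 else m₁ x) :
    AuctionInv n G price' m₁' m₂' := by
  obtain ⟨h1, h2, h3, h4, h5, h6, h7⟩ := h
  refine ⟨?_, ?_, ?_, ?_, ?_, ?_, ?_⟩
  · intro x hx y hy
    rw [hm₁' x hx, hm₂' y hy]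
    have := h1 x hx y hy
    -- Two old instances matter: the former owner of `d`, which is evicted, and `c`, which had no
    -- mate.
    have := h1 x hx d hd
    have := h1 c hc y hy
    grind
  · intro x hx
    rw [hm₁' x hx]
    have := h2 x hx
    split_ifs <;> omega
  · intro x hx
    rw [hm₂' x hx]
    have := h3 x hx
    split_ifs <;> omega
  · intro x hx y hy hm
    rw [hm₂' y hy] at hm
    split_ifs at hm with hyd
    · obtain rfl : c = x := by omega
      exact hyd ▸ hG
    · exact h4 x hx y hy hm
  · intro x hx
    rw [hprice' x hx]
    have := h5 x hx
    split_ifs <;> omega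
  · intro x hx hm
    rw [hm₂' x hx] at hm
    rw [hprice' x hx]
    split_ifs at hm with hxd
    rw [if_neg hxd]
    exact h6 x hx hm
  · intro x hx y hy z hz hm hxz
    rw [hm₂' y hy] at hm
    rw [hprice' y hy, hprice' z hz]
    split_ifs at hm with hyd
    · obtain rfl : c = x := by omega
      have := hmin z hz hxz
      split_ifs <;> omega
    · have := h7 x hx y hy z hz hm hxz
      split_ifs with hzd
      · subst hzd
        omega
      · omega

/-- No free vertex on the left has a neighbour below the price limit. -/
def Quiet (n : ℕ) (G : ℕ → ℕ → Prop) (price m₁ : ℕ → ℕ) : Prop :=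
  ∀ c < n, ∀ d < n, m₁ c = 0 → G c d → n + 2 ≤ price d

/-- Weak duality: when the auction is over, every hitting set of the disjoint families `N₁`, `N₂`
has at least as many elements as there are free vertices on the left and vertices on the right. -/
theorem AuctionInv.card_le {ι : Type*} [Nonempty ι] {n : ℕ} {G : ℕ → ℕ → Prop} {price m₁ m₂ : ℕ → ℕ}
    (h : AuctionInv n G price m₁ m₂) (hq : Quiet n G price m₁) {A B : Finset ℕ}
    (hA : ∀ a ∈ A, a < n) (hB : ∀ b ∈ B, b < n)
    (hGA : ∀ c < n, ∀ d < n, G c d → c ∈ A)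
    (N₁ N₂ : ℕ → ι → Prop) {S : Finset ι}
    (hG : ∀ a ∈ A, ∀ b ∈ B, ∀ i ∈ S, N₁ a i → N₂ b i → G a b)
    (h₁ : ∀ a ∈ A, ∃ i ∈ S, N₁ a i) (h₂ : ∀ b ∈ B, ∃ i ∈ S, N₂ b i)
    (d₁ : ∀ a ∈ A, ∀ a' ∈ A, ∀ i ∈ S, N₁ a i → N₁ a' i → a = a')
    (d₂ : ∀ a ∈ B, ∀ a' ∈ B, ∀ i ∈ S, N₂ a i → N₂ a' i → a = a') :
    (A.filter fun a => m₁ a = 0).card + B.card ≤ S.card := by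
  classical
  -- Pigeonhole: `n` prices cannot occupy all of the `n + 1` levels.
  obtain ⟨l, hl, hl'⟩ : ∃ l ∈ Finset.Icc 1 (n + 1), l ∉ (Finset.range n).image price := by
    by_contra! hcon
    have := Finset.card_le_card (show Finset.Icc 1 (n + 1) ⊆ _ from hcon)
    have h' := (Finset.card_image_le (s := Finset.range n) (f := price))
    simp at this h'
    omega
  have hlev : ∀ b < n, price b ≠ l := fun b hb he =>
    hl' (Finset.mem_image.2 ⟨b, Finset.mem_range.2 hb, he⟩)
  rw [Finset.mem_Icc] at hl
  choose! f hfS hf using h₁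
  choose! g hgS hg using h₂
  have hmate : ∀ b ∈ B, l < price b → m₂ b - 1 < n ∧ m₂ b = (m₂ b - 1) + 1 ∧ m₂ b - 1 ∈ A := by
    intro b hb hlb
    have h1 := h.price_free b (hB b hb)
    have h2 := h.right_le b (hB b hb)
    have h3 : m₂ b - 1 < n := by omega
    have h4 : m₂ b = (m₂ b - 1) + 1 := by omega
    exact ⟨h3, h4, hGA _ h3 b (hB b hb) (h.edge _ h3 b (hB b hb) h4)⟩
  -- The free vertices of `A`, the mates of the expensive vertices of `B` and the cheap vertices of
  -- `B` form an independent set of `G`. A common element of `S` in two of their sets would force an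
  -- edge or an equality, so the choice of hitting elements is injective.
  let φ : ℕ ⊕ ℕ → ι := Sum.elim f fun b => if l < price b then f (m₂ b - 1) else g b
  rw [← Finset.card_disjSum]
  -- A free vertex is no mate, and by `Quiet` all its neighbours cost at least `n + 2 > l`.
  have hfree : ∀ a ∈ A, m₁ a = 0 → ∀ b ∈ B, φ (.inl a) ≠ φ (.inr b) := by
    intro a ha hm b hb he
    simp only [φ, Sum.elim_inl, Sum.elim_inr] at he
    split_ifs at he with hlb
    · obtain ⟨h1, h2, h3⟩ := hmate b hb hlb
      have := d₁ a ha _ h3 (f a) (hfS a ha) (hf a ha) (he ▸ hf _ h3)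
      have h5 := (h.mate_iff a (hA a ha) b (hB b hb)).2 (by omega)
      omega
    · have := hq a (hA a ha) b (hB b hb) hm
        (hG a ha b hb (f a) (hfS a ha) (hf a ha) (he ▸ hg b hb))
      omega
  -- An edge would give `price b ≤ price b' + 1` by `slack`, but the unused level `l` lies strictly
  -- between the two prices.
  have hmix : ∀ b ∈ B, l < price b → ∀ b' ∈ B, ¬ l < price b' → f (m₂ b - 1) ≠ g b' := by
    intro b hb hlb b' hb' hlb' he
    obtain ⟨h1, h2, h3⟩ := hmate b hb hlb
    have := h.slack _ h1 b (hB b hb) b' (hB b' hb') h2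
      (hG _ h3 b' hb' _ (hfS _ h3) (hf _ h3) (he ▸ hg b' hb'))
    have := hlev b' (hB b' hb')
    omega
  refine Finset.card_le_card_of_injOn φ ?_ ?_
  · rintro (a | b) hx
    · simp at hx
      exact hfS a hx.1
    · simp at hx
      simp only [φ, Sum.elim_inr]
      split_ifs with hlb
      · exact hfS _ (hmate b hx hlb).2.2
      · exact hgS b hx
  · rintro (a | b) hx (a' | b') hy he
    · simp at hx hy
      rw [d₁ a hx.1 a' hy.1 (f a) (hfS a hx.1) (hf a hx.1) (by
        have : f a = f a' := he
        rw [this]; exact hf a' hy.1)]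
    · simp at hx hy
      exact absurd he (hfree a hx.1 hx.2 b' hy)
    · simp at hx hy
      exact absurd he.symm (hfree a' hy.1 hy.2 b hx)
    · simp at hx hy
      simp only [φ, Sum.elim_inr] at he
      split_ifs at he with hb hb' hb'
      · obtain ⟨h1, h2, h3⟩ := hmate b hx hb
        obtain ⟨h1', h2', h3'⟩ := hmate b' hy hb'
        have hEq := d₁ _ h3 _ h3' (f (m₂ b - 1)) (hfS _ h3) (hf _ h3) (he ▸ hf _ h3')
        have e1 := (h.mate_iff _ h1 b (hB b hx)).2 h2
        have e2 := (h.mate_iff _ h1' b' (hB b' hy)).2 h2'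
        rw [hEq] at e1
        rw [show b = b' by omega]
      · exact absurd he (hmix b hx hb b' hy hb')
      · exact absurd he.symm (hmix b' hy hb' b hx hb)
      · rw [d₂ b hx b' hy (g b) (hgS b hx) (hg b hx) (he ▸ hg b' hy)]

end AggregateSupplier

/-! ### Shorthand for expressions and conditions -/

namespace RealRAM

/-- The scalar variable `a`. -/
abbrev NExpr.var (a : ℕ) : NExpr := .get a (.const 0) (.const 0)

/-- The entry `i` of the one-dimensional array `a`. -/
abbrev NExpr.arr (a : ℕ) (i : NExpr) : NExpr := .get a i (.const 0)

/-- The condition `x ≠ 0`. -/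
abbrev Guard.nonzero (x : NExpr) : Guard := .neg (.natLe x (.const 0))

theorem LoopProg.Frame.real_eq {p : LoopProg} {s s' : State} (h : p.Frame s s')
    (hp : p.realWrites = []) : s'.real = s.real :=
  funext fun a => h.2 a (by simp [hp])

end RealRAM

namespace AggregateSupplier

open RealRAM

/-! ### Intersections of balls

Array layout. Naturals: `0`–`4` input and output, `5`–`11`, `50`, `51` loop counters, `12` the best
candidate so far, `13` prices, `14`, `15` mates, `16` the opened facilities shifted by one, `17`
their number, `18` the flag of a recorded solution, `19` witnesses for common facilities of clients
of different metrics; `t + 20`, `t + 30`, `t + 40` the selected clients, the covered clients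
and the witnesses for common facilities in metric `t`. Reals: `0`–`3` input, `4` the guessed
costs, `5` the best objective value. -/

/-- Facility `i` lies in the ball of client `j` in metric `t`. -/
def Ball (s : State) (t j i : ℕ) : Prop :=
  s.nat 2 i 0 ≠ 0 ∧ s.real (2 * t + 1) j 0 * s.real (2 * t) j i ≤ s.real 4 t 0

theorem Ball.congr {s s' : State} (h : s'.nat 2 = s.nat 2) (h' : s'.real = s.real) :
    Ball s' = Ball s := by
  funext t j i
  simp only [Ball, h, h']

/-- `x` is `0` if no number below `n` satisfies `P`, otherwise the successor of such a number. -/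
def Witness (n : ℕ) (P : ℕ → Prop) (x : ℕ) : Prop :=
  (x = 0 ∧ ∀ i < n, ¬ P i) ∨ ∃ i < n, x = i + 1 ∧ P i

theorem Witness.ne_zero_iff {n : ℕ} {P : ℕ → Prop} {x : ℕ} (h : Witness n P x) :
    x ≠ 0 ↔ ∃ i < n, P i := by
  rcases h with ⟨rfl, h⟩ | ⟨i, hi, rfl, h⟩
  · simpa using h
  · simpa using ⟨i, hi, h⟩

/-- The test whether facility `i` lies in the ball of client `j` in metric `t`. -/
def inBall (t : ℕ) (j i : NExpr) : Guard :=
  .realLe (.mul (.get (2 * t + 1) j (.const 0)) (.get (2 * t) j i)) (.get 4 (.const t) (.const 0))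

/-- Search for a common facility of two given balls. -/
def meetSearch (t u y : ℕ) : LoopProg :=
  .loop 11 0 (.ite (.conj (.nonzero (.arr 2 (.var 11)))
      (.conj (inBall t (.var 9) (.var 11)) (inBall u (.var 10) (.var 11))))
    (.setNat (y + 19) (.var 9) (.var 10) (.add (.var 11) (.const 1))) .skip)

/-- Search for a common facility of a ball in metric `t` and all balls in metric `u`. -/
def meetRow (t u y : ℕ) : LoopProg :=
  .loop 10 0 (.seq (.setNat (y + 19) (.var 9) (.var 10) (.const 0)) (meetSearch t u y))

/-- Search for common facilities of all balls in metric `t` and all balls in metric `u`. -/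
def meet (t u y : ℕ) : LoopProg := .loop 9 0 (meetRow t u y)

variable {O : (ℕ → ℝ) → ℝ}

/-- The target array has the form `y + 19` so that, for every `y`, it visibly differs from the input
arrays and the loop counters. The cell must start at `0`, since a search without success leaves it
unchanged. -/
theorem meetSearch_spec (t u y : ℕ) (s : State)
    (h0 : s.nat (y + 19) (s.nat 9 0 0) (s.nat 10 0 0) = 0) :
    Witness (s.nat 0 0 0) (fun i => Ball s t (s.nat 9 0 0) i ∧ Ball s u (s.nat 10 0 0) i)
        (((meetSearch t u y).run O s).nat (y + 19) (s.nat 9 0 0) (s.nat 10 0 0)) ∧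
      ∀ a b, ¬ (a = s.nat 9 0 0 ∧ b = s.nat 10 0 0) →
        ((meetSearch t u y).run O s).nat (y + 19) a b = s.nat (y + 19) a b := by
  refine LoopProg.loop_induction (c := 0) (fun n s' => Witness n
    (fun i => Ball s t (s.nat 9 0 0) i ∧ Ball s u (s.nat 10 0 0) i)
        (s'.nat (y + 19) (s.nat 9 0 0) (s.nat 10 0 0)) ∧
      ∀ a b, ¬ (a = s.nat 9 0 0 ∧ b = s.nat 10 0 0) →
        s'.nat (y + 19) a b = s.nat (y + 19) a b) ?_ ?_ ?_
  · intro i s x h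
    simpa using h
  · exact ⟨.inl ⟨h0, by simp⟩, fun _ _ _ => rfl⟩
  · intro i hi s' hF hv ⟨hW, hO⟩
    have e2 := hF.1 2 (by simp [LoopProg.natWrites])
    have e9 := hF.1 9 (by simp [LoopProg.natWrites])
    have e10 := hF.1 10 (by simp [LoopProg.natWrites])
    have er := hF.real_eq (by simp [LoopProg.realWrites])
    have hb : (Guard.conj (.nonzero (.arr 2 (.var 11)))
      (.conj (inBall t (.var 9) (.var 11)) (inBall u (.var 10) (.var 11)))).Holds O s' ↔
        Ball s t (s.nat 9 0 0) i ∧ Ball s u (s.nat 10 0 0) i := by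
      simp only [Guard.Holds, inBall, NExpr.eval, RExpr.eval, hv, e2, e9, e10, er, Ball]
      constructor
      · rintro ⟨h1, h2, h3⟩
        exact ⟨⟨by omega, h2⟩, by omega, h3⟩
      · rintro ⟨⟨h1, h2⟩, _, h3⟩
        exact ⟨by omega, h2, h3⟩
    rw [LoopProg.run]
    split_ifs with hc
    · simp only [LoopProg.run, NExpr.eval, hv, e9, e10, State.setNat_nat]
      refine ⟨.inr ⟨i, by omega, by simp, hb.1 hc⟩, fun a b hab => ?_⟩
      simp [hab, hO a b hab]
    · refine ⟨?_, hO⟩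
      simp only [LoopProg.run]
      rcases hW with ⟨h1, h2⟩ | ⟨j, hj, h1, h2⟩
      · refine .inl ⟨h1, fun j hj => ?_⟩
        rcases Nat.lt_succ_iff_lt_or_eq.1 hj with hj | rfl
        · exact h2 j hj
        · exact fun h => hc (hb.2 h)
      · exact .inr ⟨j, by omega, h1, h2⟩

theorem meetRow_spec (t u y : ℕ) (s : State) :
    (∀ b < s.nat 0 0 0, Witness (s.nat 0 0 0) (fun i => Ball s t (s.nat 9 0 0) i ∧ Ball s u b i)
        (((meetRow t u y).run O s).nat (y + 19) (s.nat 9 0 0) b)) ∧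
      ∀ a b, a ≠ s.nat 9 0 0 →
        ((meetRow t u y).run O s).nat (y + 19) a b = s.nat (y + 19) a b := by
  refine LoopProg.loop_induction (c := 0) (fun n s' => (∀ b < n, Witness (s.nat 0 0 0)
    (fun i => Ball s t (s.nat 9 0 0) i ∧ Ball s u b i)
        (s'.nat (y + 19) (s.nat 9 0 0) b)) ∧
      ∀ a b, a ≠ s.nat 9 0 0 → s'.nat (y + 19) a b = s.nat (y + 19) a b) ?_ ?_ ?_
  · intro i s x h
    simpa using h
  · exact ⟨by simp, fun _ _ _ => rfl⟩
  · intro i hi s' hF hv ⟨hW, hO⟩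
    have e0 := hF.1 0 (by simp [LoopProg.natWrites, meetSearch])
    have e2 := hF.1 2 (by simp [LoopProg.natWrites, meetSearch])
    have e9 := hF.1 9 (by simp [LoopProg.natWrites, meetSearch])
    have er := hF.real_eq (by simp [LoopProg.realWrites, meetSearch])
    rw [LoopProg.run]
    simp only [LoopProg.run, NExpr.eval, hv, e9]
    have := meetSearch_spec (O := O) t u y (s'.setNat (y + 19) (s.nat 9 0 0) i 0) (by
      simp [e9, hv])
    rw [Ball.congr (s' := s'.setNat (y + 19) (s.nat 9 0 0) i 0) (s := s)
      (by funext a b; simp [e2]) (by simp [er])] at this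
    simp [e9, hv, e0] at this
    refine ⟨fun b hb => ?_, fun a b ha => ?_⟩
    · rcases Nat.lt_succ_iff_lt_or_eq.1 hb with hb | rfl
      · rw [this.2 _ _ (by omega), if_neg (by omega)]
        exact hW b hb
      · exact this.1
    · rw [this.2 _ _ (by omega), if_neg (by omega)]
      exact hO a b ha

theorem meet_spec (t u y : ℕ) (s : State) :
    ∀ a < s.nat 0 0 0, ∀ b < s.nat 0 0 0,
      Witness (s.nat 0 0 0) (fun i => Ball s t a i ∧ Ball s u b i)
        (((meet t u y).run O s).nat (y + 19) a b) := by
  refine LoopProg.loop_induction (c := 0) (fun n s' => ∀ a < n, ∀ b < s.nat 0 0 0,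
      Witness (s.nat 0 0 0) (fun i => Ball s t a i ∧ Ball s u b i) (s'.nat (y + 19) a b)) ?_ ?_ ?_
  · intro i s x h
    simpa using h
  · simp
  · intro i hi s' hF hv hW a ha b hb
    have e0 := hF.1 0 (by simp [LoopProg.natWrites, meetSearch, meetRow])
    have e2 := hF.1 2 (by simp [LoopProg.natWrites, meetSearch, meetRow])
    have er := hF.real_eq (by simp [LoopProg.realWrites, meetSearch, meetRow])
    have := meetRow_spec (O := O) t u y s'
    rw [Ball.congr e2 er, e0, hv] at this
    rcases Nat.lt_succ_iff_lt_or_eq.1 ha with ha | rfl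
    · rw [this.2 _ _ (by omega)]
      exact hW a ha b hb
    · exact this.1 b hb

/-! ### Greedy selection -/

/-- `x` is `0` if no number below `n` satisfies `P`, otherwise the successor of such a number
that is `r`-maximal among them. -/
def IsBest (n : ℕ) (P : ℕ → Prop) (r : ℕ → ℕ → Prop) (x : ℕ) : Prop :=
  (x = 0 ∧ ∀ i < n, ¬ P i) ∨ ∃ i < n, x = i + 1 ∧ P i ∧ ∀ j < n, P j → r j i

/-- A linear scan for a maximum, used both for the heaviest uncovered client and for the cheapest
neighbour. Replacing the candidate needs transitivity of `r`; keeping it needs totality, as a failed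
comparison must put the new element below the candidate. -/
theorem select_spec {b : Guard} {v : ℕ} (hv : v ≠ 12) {P : ℕ → Prop}
    {r : ℕ → ℕ → Prop}
    (total : ∀ x y, r x y ∨ r y x) (trans : ∀ x y z, r x y → r y z → r x z) (s : State)
    (hb : ∀ i < s.nat 0 0 0, ∀ s' : State, s'.nat v 0 0 = i →
      (∀ a, a ≠ v → a ≠ 12 → s'.nat a = s.nat a) → s'.real = s.real →
      (b.Holds O s' ↔ P i ∧ ¬ (s'.nat 12 0 0 ≠ 0 ∧ ¬ r (s'.nat 12 0 0 - 1) i)))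
    (h12 : s.nat 12 0 0 = 0) :
    IsBest (s.nat 0 0 0) P r (((LoopProg.loop v 0 (.ite b
      (.setNat 12 (.const 0) (.const 0) (.add (.var v) (.const 1))) .skip)).run O s).nat 12 0 0) := by
  refine LoopProg.loop_induction (c := 0) (fun n s' => IsBest n P r (s'.nat 12 0 0)) ?_ ?_ ?_
  · intro i s x h
    simpa [hv.symm] using h
  · exact .inl ⟨h12, by simp⟩
  · intro i hi s' hF hvi h
    have hbi := hb i hi s' hvi (fun a h1 h2 => hF.1 a (by simp [LoopProg.natWrites, h1, h2]))
      (hF.real_eq (by simp [LoopProg.realWrites]))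
    rw [LoopProg.run]
    split_ifs with hc
    · obtain ⟨hPi, hm⟩ := hbi.1 hc
      simp only [LoopProg.run, NExpr.eval, hvi, State.setNat_nat]
      refine .inr ⟨i, by omega, by simp, hPi, fun j hj hPj => ?_⟩
      have hrefl : ∀ x, r x x := fun x => (total x x).elim id id
      rcases Nat.lt_succ_iff_lt_or_eq.1 hj with hj | rfl
      · rcases h with ⟨_, h2⟩ | ⟨m, hm', h1, h2, h3⟩
        · exact absurd hPj (h2 j hj)
        · rw [h1] at hm
          simp only [ne_eq, Nat.add_eq_zero_iff, one_ne_zero, and_false, not_false_eq_true,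
            Nat.add_sub_cancel, true_and, not_not] at hm
          exact trans _ _ _ (h3 j hj hPj) hm
      · exact hrefl _
    · simp only [LoopProg.run]
      rcases h with ⟨h1, h2⟩ | ⟨m, hm', h1, h2, h3⟩
      · refine .inl ⟨h1, fun j hj hPj => ?_⟩
        rcases Nat.lt_succ_iff_lt_or_eq.1 hj with hj | rfl
        · exact h2 j hj hPj
        · exact hc (hbi.2 ⟨hPj, by simp [h1]⟩)
      · refine .inr ⟨m, by omega, h1, h2, fun j hj hPj => ?_⟩
        rcases Nat.lt_succ_iff_lt_or_eq.1 hj with hj | rfl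
        · exact h3 j hj hPj
        · by_contra hr
          refine hc (hbi.2 ⟨hPj, ?_⟩)
          rw [h1]
          rintro ⟨_, h5⟩
          exact (total j m).elim hr h5

/-- Find an uncovered client of maximal weight. -/
def greedyBest (t : ℕ) : LoopProg :=
  .loop 10 0 (.ite (.conj (.conj (.nonzero (.arr 3 (.var 10))) (.natLe (.arr (t + 30) (.var 10)) (.const 0)))
    (.neg (.conj (.nonzero (.var 12)) (.neg (.realLe
      (.get (2 * t + 1) (.sub (.var 12) (.const 1)) (.const 0))
      (.get (2 * t + 1) (.var 10) (.const 0)))))))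
    (.setNat 12 (.const 0) (.const 0) (.add (.var 10) (.const 1))) .skip)

theorem greedyBest_spec (t : ℕ) (s : State) (h12 : s.nat 12 0 0 = 0) :
    IsBest (s.nat 0 0 0) (fun j => s.nat 3 j 0 ≠ 0 ∧ s.nat (t + 30) j 0 = 0)
      (fun i j => s.real (2 * t + 1) i 0 ≤ s.real (2 * t + 1) j 0)
      (((greedyBest t).run O s).nat 12 0 0) := by
  refine select_spec (v := 10)
    (r := fun i j => s.real (2 * t + 1) i 0 ≤ s.real (2 * t + 1) j 0) (by simp) 
    (fun x y => le_total _ _) (fun x y z => le_trans) s ?_ h12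
  intro i hi s' hv hF hR
  have e3 := hF 3 (by simp) (by simp)
  have ec := hF (t + 30) (by simp) (by simp)
  simp [Guard.Holds, NExpr.eval, RExpr.eval, hv, e3, ec, hR]

/-- Mark the clients whose ball meets the ball of the chosen client. -/
def greedyMark (t : ℕ) : LoopProg :=
  .loop 10 0 (.ite (.nonzero (.get (t + 40) (.sub (.var 12) (.const 1)) (.var 10)))
    (.setNat (t + 30) (.var 10) (.const 0) (.const 1)) .skip)

theorem greedyMark_spec (t : ℕ) (s : State) :
    ∀ b, ((greedyMark t).run O s).nat (t + 30) b 0 ≠ 0 ↔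
      (b < s.nat 0 0 0 ∧ s.nat (t + 40) (s.nat 12 0 0 - 1) b ≠ 0) ∨ s.nat (t + 30) b 0 ≠ 0 := by
  refine LoopProg.loop_induction (c := 0) (fun n s' => ∀ b, s'.nat (t + 30) b 0 ≠ 0 ↔
      (b < n ∧ s.nat (t + 40) (s.nat 12 0 0 - 1) b ≠ 0) ∨ s.nat (t + 30) b 0 ≠ 0) ?_ ?_ ?_
  · intro i s x h
    simpa using h
  · simp
  · intro i hi s' hF hv h b
    have e12 := hF.1 12 (by simp [LoopProg.natWrites])
    have ex := hF.1 (t + 40) (by simp [LoopProg.natWrites])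
    have hb := h b
    simp only [LoopProg.run, Guard.Holds, NExpr.eval, hv, e12, ex]
    split_ifs with hc
    rotate_left
    · simp only [State.setNat_nat]
      by_cases hbi : b = i
      · subst hbi
        simp
        left
        omega
      · simp [hbi]
        rw [show b ≤ i ↔ b < i by omega]
        simpa using hb
    · rw [hb]
      by_cases hbi : b = i
      · subst hbi
        simp at hc
        simp [hc]
      · rw [show b < i + 1 ↔ b < i by omega]

/-- One round of the greedy selection. -/
def greedyRound (t : ℕ) : LoopProg :=
  .seq (.setNat 12 (.const 0) (.const 0) (.const 0)) <| .seq (greedyBest t) <|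
  .ite (.nonzero (.var 12))
    (.seq (.setNat (t + 20) (.sub (.var 12) (.const 1)) (.const 0) (.const 1)) <|
      .seq (.setNat (t + 30) (.sub (.var 12) (.const 1)) (.const 0) (.const 1)) (greedyMark t))
    .skip

/-- The invariant of the greedy selection in terms of the memory. -/
def GreedyState (t : ℕ) (M : ℕ → ℕ → Prop) (s : State) : Prop :=
  GreedyInv (s.nat 0 0 0) (fun j => s.nat 3 j 0 ≠ 0) (fun j => s.real (2 * t + 1) j 0) M
    (fun j => s.nat (t + 20) j 0) (fun j => s.nat (t + 30) j 0)

/-- The uncovered clients. -/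
def uncovered (t : ℕ) (s : State) : Finset ℕ :=
  (Finset.range (s.nat 0 0 0)).filter fun j => s.nat 3 j 0 ≠ 0 ∧ s.nat (t + 30) j 0 = 0

/-- The chosen client itself leaves the uncovered set. If there is none to choose, that set is
already empty and the truncated subtraction makes the bound trivial. -/
theorem greedyRound_spec (t : ℕ) {M : ℕ → ℕ → Prop} (hM : ∀ a b, M a b → M b a) (s : State)
    (hX : ∀ a < s.nat 0 0 0, ∀ b < s.nat 0 0 0, s.nat (t + 40) a b ≠ 0 ↔ M a b)
    (h : GreedyState t M s) :
    GreedyState t M ((greedyRound t).run O s) ∧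
      (uncovered t ((greedyRound t).run O s)).card ≤ (uncovered t s).card - 1 := by
  set s₁ := (greedyBest t).run O (s.setNat 12 0 0 0) with hs₁
  have hF₁ := LoopProg.frame_run O (greedyBest t) (s.setNat 12 0 0 0)
  rw [← hs₁] at hF₁
  have eR : s₁.real = s.real := by
    rw [hF₁.real_eq (by simp [LoopProg.realWrites, greedyBest])]
    rfl
  have eN : ∀ a, a ≠ 10 → a ≠ 12 → s₁.nat a = s.nat a := by
    intro a h1 h2
    rw [hF₁.1 a (by simp [LoopProg.natWrites, greedyBest, h1, h2])]
    funext i j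
    simp [h2]
  have hbest := greedyBest_spec (O := O) t (s.setNat 12 0 0 0) (by simp)
  rw [← hs₁] at hbest
  simp only [State.setNat_nat, State.setNat_real] at hbest
  simp at hbest
  have hrun : (greedyRound t).run O s = if s₁.nat 12 0 0 ≠ 0 then
      (greedyMark t).run O ((s₁.setNat (t + 20) (s₁.nat 12 0 0 - 1) 0 1).setNat (t + 30)
        (s₁.nat 12 0 0 - 1) 0 1) else s₁ := by
    simp [greedyRound, LoopProg.run, NExpr.eval, Guard.Holds, ← hs₁]
  have e0 := eN 0 (by simp) (by simp)
  have e3 := eN 3 (by simp) (by simp)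
  have eS := eN (t + 20) (by simp) (by simp)
  have eC := eN (t + 30) (by simp) (by simp)
  have eX := eN (t + 40) (by simp) (by simp)
  rcases hbest with ⟨h1, h2⟩ | ⟨m, hm, h1, ⟨h2, h3⟩, h4⟩
  · rw [hrun, if_neg (by simp [h1])]
    refine ⟨by simpa only [GreedyState, e0, e3, eS, eC, eR] using h, ?_⟩
    have : uncovered t s₁ = ∅ := by
      simp only [uncovered, e0, e3, eC]
      refine Finset.filter_eq_empty_iff.2 fun j hj hh => ?_
      exact h2 j (by simpa using hj) hh
    simp [this]
  · rw [hrun, if_pos (by simp [h1]), h1, Nat.add_sub_cancel]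
    set s₂ := (s₁.setNat (t + 20) m 0 1).setNat (t + 30) m 0 1 with hs₂
    set s₃ := (greedyMark t).run O s₂ with hs₃
    have hF₃ := LoopProg.frame_run O (greedyMark t) s₂
    rw [← hs₃] at hF₃
    have g0 : s₃.nat 0 = s.nat 0 := by
      rw [hF₃.1 0 (by simp [LoopProg.natWrites, greedyMark]), ← e0]
      funext i j
      simp [hs₂]
    have g3 : s₃.nat 3 = s.nat 3 := by
      rw [hF₃.1 3 (by simp [LoopProg.natWrites, greedyMark]), ← e3]
      funext i j
      simp [hs₂]
    have gR : s₃.real = s.real := by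
      rw [hF₃.real_eq (by simp [LoopProg.realWrites, greedyMark]), ← eR]
      rfl
    have gS : ∀ b, s₃.nat (t + 20) b 0 = if b = m then 1 else s.nat (t + 20) b 0 := by
      intro b
      rw [hF₃.1 (t + 20) (by simp [LoopProg.natWrites, greedyMark]), ← eS]
      simp [hs₂]
    have gC : ∀ b < s.nat 0 0 0,
        s₃.nat (t + 30) b 0 ≠ 0 ↔ (b = m ∨ M m b) ∨ s.nat (t + 30) b 0 ≠ 0 := by
      intro b hb
      rw [hs₃, greedyMark_spec, ← hX m hm b hb]
      simp [hs₂, h1, e0, eC, eX, hb]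
      by_cases hbm : b = m <;> simp [hbm]
    have key : GreedyState t M s₃ := by
      simp only [GreedyState, g0, g3, gR]
      refine GreedyInv.step h hM hm h2 h3 (fun b hb hC hc => h4 b hb ⟨hC, hc⟩) ?_ gC
      intro b _
      rw [gS]
      by_cases hbm : b = m <;> simp [hbm]
    refine ⟨key, Nat.le_sub_one_of_lt (Finset.card_lt_card ?_)⟩
    refine ⟨fun j hj => ?_, fun hsub => ?_⟩
    · simp only [uncovered, g0, g3, Finset.mem_filter, Finset.mem_range] at hj ⊢
      refine ⟨hj.1, hj.2.1, ?_⟩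
      by_contra hne
      exact (gC j hj.1).2 (.inr hne) hj.2.2
    · have hmem : m ∈ uncovered t s := by simp [uncovered, hm, h2, h3]
      have := hsub hmem
      simp only [uncovered, g0, g3, Finset.mem_filter, Finset.mem_range] at this
      exact (gC m hm).2 (.inl (.inl rfl)) this.2.2

/-- Unselect and uncover all clients. -/
def greedyClear (t : ℕ) : LoopProg :=
  .loop 9 0 (.seq (.setNat (t + 20) (.var 9) (.const 0) (.const 0))
    (.setNat (t + 30) (.var 9) (.const 0) (.const 0)))

theorem greedyClear_spec (t : ℕ) (s : State) :
    ∀ a < s.nat 0 0 0, ((greedyClear t).run O s).nat (t + 20) a 0 = 0 ∧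
      ((greedyClear t).run O s).nat (t + 30) a 0 = 0 := by
  refine LoopProg.loop_induction (c := 0) (fun n s' => ∀ a < n, s'.nat (t + 20) a 0 = 0 ∧
      s'.nat (t + 30) a 0 = 0) ?_ ?_ ?_
  · intro i s x h
    simpa using h
  · simp
  · intro i hi s' hF hv h a ha
    simp [LoopProg.run, NExpr.eval, hv]
    have := h a
    constructor <;> intro <;> [apply (this _).1; apply (this _).2] <;> omega

/-- The greedy selection of clients with pairwise disjoint balls in metric `t`. -/
def greedy (t : ℕ) : LoopProg := .seq (greedyClear t) (.loop 9 0 (greedyRound t))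

/-- There are at most `n` uncovered clients at the start and each round removes one while any is
left, so `n` rounds suffice. -/
theorem greedy_spec (t : ℕ) {M : ℕ → ℕ → Prop} (hM : ∀ a b, M a b → M b a) (s : State)
    (hX : ∀ a < s.nat 0 0 0, ∀ b < s.nat 0 0 0, s.nat (t + 40) a b ≠ 0 ↔ M a b) :
    GreedyState t M ((greedy t).run O s) ∧
      ∀ b < s.nat 0 0 0, s.nat 3 b 0 ≠ 0 → ((greedy t).run O s).nat (t + 30) b 0 ≠ 0 := by
  set s₁ := (greedyClear t).run O s with hs₁
  have hF₁ := LoopProg.frame_run O (greedyClear t) s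
  have hcl := greedyClear_spec (O := O) t s
  rw [← hs₁] at hF₁ hcl
  have e0 := hF₁.1 0 (by simp [LoopProg.natWrites, greedyClear])
  have e3 := hF₁.1 3 (by simp [LoopProg.natWrites, greedyClear])
  have eX := hF₁.1 (t + 40) (by simp [LoopProg.natWrites, greedyClear])
  have main := LoopProg.loop_induction (O := O) (v := 9) (c := 0) (p := greedyRound t) (s₀ := s₁)
    (fun i s' => GreedyState t M s' ∧ (uncovered t s').card ≤ s.nat 0 0 0 - i)
    (by
      intro i s x h
      simpa [GreedyState, uncovered] using h)
    (by
      constructor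
      · have hz : ∀ a < s₁.nat 0 0 0, s₁.nat (t + 20) a 0 = 0 ∧ s₁.nat (t + 30) a 0 = 0 := by
          rwa [e0]
        constructor
        · exact fun a ha h => absurd (hz a ha).1 h
        · exact fun a ha b hb h => absurd (hz a ha).1 h
        · exact fun a ha b hb h => absurd (hz a ha).1 h
        · exact fun b hb _ h => absurd (hz b hb).2 h
      · rw [uncovered, e0]
        exact (Finset.card_filter_le _ _).trans (by simp))
    (by
      intro i hi s' hF hv ⟨hG, hU⟩
      have g0 := hF.1 0 (by simp [LoopProg.natWrites, greedyRound, greedyBest, greedyMark])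
      have gX := hF.1 (t + 40) (by simp [LoopProg.natWrites, greedyRound, greedyBest, greedyMark])
      obtain ⟨h1, h2⟩ := greedyRound_spec (O := O) t hM s' (by rwa [g0, gX, e0, eX]) hG
      exact ⟨h1, by omega⟩)
  have hF₂ := LoopProg.frame_run O (.loop 9 0 (greedyRound t)) s₁
  rw [e0] at main
  have hrun : (greedy t).run O s = (LoopProg.loop 9 0 (greedyRound t)).run O s₁ := rfl
  rw [hrun]
  refine ⟨main.1, fun b hb hC hcov => ?_⟩
  have hemp : uncovered t ((LoopProg.loop 9 0 (greedyRound t)).run O s₁) = ∅ := by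
    rw [← Finset.card_eq_zero]
    have := main.2
    omega
  have g0 := hF₂.1 0 (by simp [LoopProg.natWrites, greedyRound, greedyBest, greedyMark])
  have g3 := hF₂.1 3 (by simp [LoopProg.natWrites, greedyRound, greedyBest, greedyMark])
  have hmem : b ∈ uncovered t ((LoopProg.loop 9 0 (greedyRound t)).run O s₁) := by
    simp only [uncovered, g0, g3, e0, e3, Finset.mem_filter, Finset.mem_range]
    exact ⟨hb, hC, hcov⟩
  simp [hemp] at hmem

/-! ### The auction -/

/-- The bipartite graph between the selected clients of the two metrics. -/
def Edge (s : State) (c d : ℕ) : Prop :=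
  s.nat 20 c 0 ≠ 0 ∧ s.nat 21 d 0 ≠ 0 ∧ s.nat 19 c d ≠ 0

/-- The auction invariant in terms of the memory. -/
def AuctionState (s : State) : Prop :=
  AuctionInv (s.nat 0 0 0) (Edge s) (fun d => s.nat 13 d 0) (fun c => s.nat 14 (c + 1) 0)
    fun d => s.nat 15 d 0

/-- Client `c` is free and has a neighbour below the price limit. -/
def Active (s : State) (c : ℕ) : Prop :=
  s.nat 14 (c + 1) 0 = 0 ∧ ∃ d < s.nat 0 0 0, Edge s c d ∧ s.nat 13 d 0 < s.nat 0 0 0 + 2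

/-- The sum of the prices. -/
def totalPrice (s : State) : ℕ := ∑ d ∈ Finset.range (s.nat 0 0 0), s.nat 13 d 0

/-- The graph is the same in both states. -/
def SameGraph (s s' : State) : Prop :=
  s'.nat 0 = s.nat 0 ∧ s'.nat 19 = s.nat 19 ∧ s'.nat 20 = s.nat 20 ∧ s'.nat 21 = s.nat 21

/-- The prices and the matching are the same in both states. -/
def SameMatching (s s' : State) : Prop :=
  s'.nat 13 = s.nat 13 ∧ s'.nat 14 = s.nat 14 ∧ s'.nat 15 = s.nat 15

theorem SameGraph.edge {s s' : State} (h : SameGraph s s') : Edge s' = Edge s := by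
  obtain ⟨_, h1, h2, h3⟩ := h
  funext c d
  simp only [Edge, h1, h2, h3]

theorem SameMatching.active {s s' : State} (h : SameMatching s s') (hG : SameGraph s s') :
    Active s' = Active s := by
  funext c
  simp only [Active, hG.edge, hG.1, h.1, h.2.1]

theorem SameMatching.auctionState {s s' : State} (h : SameMatching s s') (hG : SameGraph s s') :
    AuctionState s' ↔ AuctionState s := by
  simp only [AuctionState, hG.edge, hG.1, h.1, h.2.1, h.2.2]

theorem SameMatching.totalPrice {s s' : State} (h : SameMatching s s') (hG : SameGraph s s') :
    totalPrice s' = totalPrice s := by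
  simp only [AggregateSupplier.totalPrice, hG.1, h.1]

/-- Find a neighbour of minimal price. -/
def bidBest : LoopProg :=
  .loop 10 0 (.ite (.conj (.conj (.nonzero (.arr 21 (.var 10)))
      (.nonzero (.get 19 (.var 9) (.var 10))))
    (.neg (.conj (.nonzero (.var 12)) (.neg (.natLe
      (.arr 13 (.var 10)) (.arr 13 (.sub (.var 12) (.const 1))))))))
    (.setNat 12 (.const 0) (.const 0) (.add (.var 10) (.const 1))) .skip)

theorem bidBest_spec (s : State) (h12 : s.nat 12 0 0 = 0) :
    IsBest (s.nat 0 0 0) (fun d => s.nat 21 d 0 ≠ 0 ∧ s.nat 19 (s.nat 9 0 0) d ≠ 0)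
      (fun x y => s.nat 13 y 0 ≤ s.nat 13 x 0) ((bidBest.run O s).nat 12 0 0) := by
  refine select_spec (v := 10) (r := fun x y => s.nat 13 y 0 ≤ s.nat 13 x 0) (by simp)
    (fun x y => le_total _ _) (fun x y z h1 h2 => h2.trans h1) s ?_ h12
  intro i hi s' hv hF hR
  have e9 := hF 9 (by simp) (by simp)
  have e13 := hF 13 (by simp) (by simp)
  have e19 := hF 19 (by simp) (by simp)
  have e21 := hF 21 (by simp) (by simp)
  simp [Guard.Holds, NExpr.eval, hv, e9, e13, e19, e21]

/-- Match the client `c` of the first metric to the chosen client of the second metric. -/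
def assign : LoopProg :=
  .seq (.setNat 14 (.arr 15 (.sub (.var 12) (.const 1))) (.const 0) (.const 0)) <|
  .seq (.setNat 15 (.sub (.var 12) (.const 1)) (.const 0) (.add (.var 9) (.const 1))) <|
  .seq (.setNat 14 (.add (.var 9) (.const 1)) (.const 0) (.var 12))
    (.setNat 13 (.sub (.var 12) (.const 1)) (.const 0)
      (.add (.arr 13 (.sub (.var 12) (.const 1))) (.const 1)))

/-- A free client bids for a cheapest neighbour. -/
def bidStep : LoopProg :=
  .ite (.conj (.nonzero (.arr 20 (.var 9))) (.natLe (.arr 14 (.add (.var 9) (.const 1))) (.const 0)))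
    (.seq (.setNat 12 (.const 0) (.const 0) (.const 0)) <| .seq bidBest <|
      .ite (.conj (.nonzero (.var 12)) (.neg (.natLe (.add (.var 0) (.const 2))
        (.arr 13 (.sub (.var 12) (.const 1)))))) assign .skip)
    .skip

theorem sameGraph_of_frame {p : LoopProg} {s s' : State} (hF : p.Frame s s')
    (h0 : 0 ∉ p.natWrites) (h1 : 19 ∉ p.natWrites) (h2 : 20 ∉ p.natWrites)
    (h3 : 21 ∉ p.natWrites) : SameGraph s s' :=
  ⟨hF.1 0 h0, hF.1 19 h1, hF.1 20 h2, hF.1 21 h3⟩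

theorem bidStep_sameGraph (s : State) : SameGraph s (bidStep.run O s) :=
  sameGraph_of_frame (LoopProg.frame_run O bidStep s)
    (by simp [LoopProg.natWrites, bidStep, bidBest, assign])
    (by simp [LoopProg.natWrites, bidStep, bidBest, assign])
    (by simp [LoopProg.natWrites, bidStep, bidBest, assign])
    (by simp [LoopProg.natWrites, bidStep, bidBest, assign])

/-- The mates of the first metric are stored with indices shifted by one, so that evicting the owner
of `d` needs no case distinction: if `d` is free, the eviction writes to the unused cell `0`. -/
theorem assign_spec (s : State) (h : AuctionState s) {c d : ℕ} (h9 : s.nat 9 0 0 = c)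
    (h12 : s.nat 12 0 0 = d + 1) (hc : c < s.nat 0 0 0) (hd : d < s.nat 0 0 0)
    (hfree : s.nat 14 (c + 1) 0 = 0) (hE : Edge s c d) (hp : s.nat 13 d 0 < s.nat 0 0 0 + 2)
    (hmin : ∀ d' < s.nat 0 0 0, Edge s c d' → s.nat 13 d 0 ≤ s.nat 13 d' 0) :
    AuctionState (assign.run O s) ∧ totalPrice (assign.run O s) = totalPrice s + 1 := by
  have hG : SameGraph s (assign.run O s) := by
    refine sameGraph_of_frame (LoopProg.frame_run O assign s) ?_ ?_ ?_ ?_ <;>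
      simp [LoopProg.natWrites, assign]
  have e13 : ∀ x, (assign.run O s).nat 13 x 0 =
      if x = d then s.nat 13 d 0 + 1 else s.nat 13 x 0 := by
    intro x
    simp [assign, LoopProg.run, NExpr.eval, h9, h12]
  have e15 : ∀ x, (assign.run O s).nat 15 x 0 = if x = d then c + 1 else s.nat 15 x 0 := by
    intro x
    simp [assign, LoopProg.run, NExpr.eval, h9, h12]
  have e14 : ∀ x, (assign.run O s).nat 14 (x + 1) 0 =
      if x = c then d + 1 else if x + 1 = s.nat 15 d 0 then 0 else s.nat 14 (x + 1) 0 := by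
    intro x
    simp [assign, LoopProg.run, NExpr.eval, h9, h12]
  constructor
  · rw [AuctionState, hG.edge, hG.1]
    exact h.bid hc hd hfree hE hp hmin (fun x _ => e13 x) (fun x _ => e15 x) (fun x _ => e14 x)
  · simp only [totalPrice, hG.1, e13]
    rw [← Finset.add_sum_erase _ _ (Finset.mem_range.2 hd),
      ← Finset.add_sum_erase _ (fun x => s.nat 13 x 0) (Finset.mem_range.2 hd), if_pos rfl,
      Finset.sum_congr rfl fun x hx => if_neg (Finset.ne_of_mem_erase hx)]
    omega

/-- An active client always bids, since its cheapest neighbour is below the limit as soon as any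
neighbour is. The total price thus detects whether a bid took place. -/
theorem bidStep_spec (s : State) (h : AuctionState s) (hc : s.nat 9 0 0 < s.nat 0 0 0) :
    AuctionState (bidStep.run O s) ∧
      ((SameMatching s (bidStep.run O s) ∧ ¬ Active s (s.nat 9 0 0)) ∨
        (Active s (s.nat 9 0 0) ∧ totalPrice (bidStep.run O s) = totalPrice s + 1)) := by
  set c := s.nat 9 0 0 with hcdef
  by_cases hb : s.nat 20 c 0 ≠ 0 ∧ s.nat 14 (c + 1) 0 = 0
  swap
  · have hrun : bidStep.run O s = s := by
      rw [bidStep, LoopProg.run, if_neg]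
      · rfl
      · simpa [Guard.Holds, NExpr.eval, ← hcdef] using hb
    rw [hrun]
    -- Unselected clients have no edges and are therefore never active.
    exact ⟨h, .inl ⟨⟨rfl, rfl, rfl⟩, fun ⟨h1, d, _, h2, _⟩ => hb ⟨h2.1, h1⟩⟩⟩
  obtain ⟨hsel, hfree⟩ := hb
  set s₁ := bidBest.run O (s.setNat 12 0 0 0) with hs₁
  have hF₁ := LoopProg.frame_run O bidBest (s.setNat 12 0 0 0)
  rw [← hs₁] at hF₁
  have eN : ∀ a, a ≠ 10 → a ≠ 12 → s₁.nat a = s.nat a := by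
    intro a h1 h2
    rw [hF₁.1 a (by simp [LoopProg.natWrites, bidBest, h1, h2])]
    funext i j
    simp [h2]
  have hbest := bidBest_spec (O := O) (s.setNat 12 0 0 0) (by simp)
  rw [← hs₁] at hbest
  simp only [State.setNat_nat] at hbest
  simp only [IsBest, Nat.reduceEqDiff, false_and, if_false, ← hcdef] at hbest
  have hrun : bidStep.run O s = if s₁.nat 12 0 0 ≠ 0 ∧
      s.nat 13 (s₁.nat 12 0 0 - 1) 0 < s.nat 0 0 0 + 2 then assign.run O s₁ else s₁ := by
    rw [bidStep, LoopProg.run, if_pos]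
    · simp [LoopProg.run, NExpr.eval, Guard.Holds, ← hs₁, eN 13, eN 0]
    · simpa [Guard.Holds, NExpr.eval, ← hcdef] using ⟨hsel, hfree⟩
  have hG₁ : SameGraph s s₁ :=
    ⟨eN 0 (by simp) (by simp), eN 19 (by simp) (by simp), eN 20 (by simp) (by simp),
      eN 21 (by simp) (by simp)⟩
  have hM₁ : SameMatching s s₁ :=
    ⟨eN 13 (by simp) (by simp), eN 14 (by simp) (by simp), eN 15 (by simp) (by simp)⟩
  rcases hbest with ⟨h1, h2⟩ | ⟨d, hd, h1, h2, h3⟩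
  · rw [hrun, if_neg (by simp [h1])]
    refine ⟨(hM₁.auctionState hG₁).2 h, .inl ⟨hM₁, ?_⟩⟩
    rintro ⟨_, d, hd, he, _⟩
    exact h2 d hd he.2
  · have hE : Edge s c d := ⟨hsel, h2⟩
    have hmin : ∀ d' < s.nat 0 0 0, Edge s c d' → s.nat 13 d 0 ≤ s.nat 13 d' 0 :=
      fun d' hd' he => h3 d' hd' he.2
    by_cases hp : s.nat 13 d 0 < s.nat 0 0 0 + 2
    · rw [hrun, if_pos (by simpa [h1] using hp)]
      have := assign_spec (O := O) s₁ ((hM₁.auctionState hG₁).2 h) (c := c) (d := d)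
        (by rw [eN 9 (by simp) (by simp)]) h1 (by rwa [hG₁.1]) (by rwa [hG₁.1])
        (by rwa [hM₁.2.1]) (by rwa [hG₁.edge]) (by rwa [hM₁.1, hG₁.1])
        (by rwa [hM₁.1, hG₁.1, hG₁.edge])
      rw [hM₁.totalPrice hG₁] at this
      exact ⟨this.1, .inr ⟨⟨hfree, d, hd, hE, hp⟩, this.2⟩⟩
    · rw [hrun, if_neg (by simpa [h1] using hp)]
      refine ⟨(hM₁.auctionState hG₁).2 h, .inl ⟨hM₁, ?_⟩⟩
      rintro ⟨_, d', hd', he, hp'⟩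
      have := hmin d' hd' he
      omega

/-- Every client of the first metric may bid once. -/
def bidRound : LoopProg := .loop 9 0 bidStep

theorem bidRound_sameGraph (s : State) : SameGraph s (bidRound.run O s) :=
  sameGraph_of_frame (LoopProg.frame_run O bidRound s)
    (by simp [LoopProg.natWrites, bidRound, bidStep, bidBest, assign])
    (by simp [LoopProg.natWrites, bidRound, bidStep, bidBest, assign])
    (by simp [LoopProg.natWrites, bidRound, bidStep, bidBest, assign])
    (by simp [LoopProg.natWrites, bidRound, bidStep, bidBest, assign])

/-- Until the first bid, prices and matching are those of `s`, so activity can be tested in `s`;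
after it, the total price stays above its initial value. A round without bids therefore proves that
nobody was active. -/
theorem bidRound_spec (s : State) (h : AuctionState s) :
    AuctionState (bidRound.run O s) ∧
      ((SameMatching s (bidRound.run O s) ∧ ∀ c < s.nat 0 0 0, ¬ Active s c) ∨
        ((∃ c < s.nat 0 0 0, Active s c) ∧ totalPrice s < totalPrice (bidRound.run O s))) := by
  refine LoopProg.loop_induction (c := 0) (fun n s' => AuctionState s' ∧
      ((SameMatching s s' ∧ ∀ c < n, ¬ Active s c) ∨
        ((∃ c < s.nat 0 0 0, Active s c) ∧ totalPrice s < totalPrice s'))) ?_ ?_ ?_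
  · intro i s' x h
    have hM : SameMatching s' (s'.setNat 9 0 0 x) := by
      refine ⟨?_, ?_, ?_⟩ <;> funext a b <;> simp
    have hG : SameGraph s' (s'.setNat 9 0 0 x) := by
      refine ⟨?_, ?_, ?_, ?_⟩ <;> funext a b <;> simp
    rw [hM.auctionState hG, hM.totalPrice hG]
    simp only [SameMatching, hM.1, hM.2.1, hM.2.2] at h ⊢
    exact h
  · exact ⟨h, .inl ⟨⟨rfl, rfl, rfl⟩, by simp⟩⟩
  · intro i hi s' hF hv ⟨hA, hP⟩
    have hG : SameGraph s s' := by
      refine sameGraph_of_frame hF ?_ ?_ ?_ ?_ <;>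
        simp [LoopProg.natWrites, bidStep, bidBest, assign]
    obtain ⟨h1, h2⟩ := bidStep_spec (O := O) s' hA (by rw [hv, hG.1]; omega)
    rw [hv] at h2
    refine ⟨h1, ?_⟩
    rcases hP with ⟨hM, hQ⟩ | ⟨hE, hT⟩
    · rw [hM.active hG, hM.totalPrice hG] at h2
      rcases h2 with ⟨hM', hn⟩ | ⟨ha, ht⟩
      · refine .inl ⟨⟨hM'.1.trans hM.1, hM'.2.1.trans hM.2.1, hM'.2.2.trans hM.2.2⟩, ?_⟩
        intro c hc
        rcases Nat.lt_succ_iff_lt_or_eq.1 hc with hc | rfl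
        · exact hQ c hc
        · exact hn
      · exact .inr ⟨⟨i, by omega, ha⟩, by omega⟩
    · refine .inr ⟨hE, ?_⟩
      rcases h2 with ⟨hM', hn⟩ | ⟨ha, ht⟩
      · rwa [hM'.totalPrice (bidStep_sameGraph s')]
      · omega

/-- Start with prices `0` and the empty matching. -/
def auctionClear : LoopProg :=
  .loop 9 0 (.seq (.setNat 13 (.var 9) (.const 0) (.const 0)) <|
    .seq (.setNat 14 (.add (.var 9) (.const 1)) (.const 0) (.const 0))
      (.setNat 15 (.var 9) (.const 0) (.const 0)))

theorem auctionClear_spec (s : State) : ∀ a < s.nat 0 0 0,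
    (auctionClear.run O s).nat 13 a 0 = 0 ∧ (auctionClear.run O s).nat 14 (a + 1) 0 = 0 ∧
      (auctionClear.run O s).nat 15 a 0 = 0 := by
  refine LoopProg.loop_induction (c := 0) (fun n s' => ∀ a < n, s'.nat 13 a 0 = 0 ∧
      s'.nat 14 (a + 1) 0 = 0 ∧ s'.nat 15 a 0 = 0) ?_ ?_ ?_
  · intro i s x h
    simpa using h
  · simp
  · intro i hi s' hF hv h a ha
    simp [LoopProg.run, NExpr.eval, hv]
    have := h a
    refine ⟨?_, ?_, ?_⟩ <;> intro
    · exact (this (by omega)).1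
    · exact (this (by omega)).2.1
    · exact (this (by omega)).2.2

theorem auctionState_clear (s : State) : AuctionState (auctionClear.run O s) := by
  have h := auctionClear_spec (O := O) s
  have hG : SameGraph s (auctionClear.run O s) := by
    refine sameGraph_of_frame (LoopProg.frame_run O auctionClear s) ?_ ?_ ?_ ?_ <;>
      simp [LoopProg.natWrites, auctionClear]
  rw [AuctionState, hG.1]
  refine ⟨?_, ?_, ?_, ?_, ?_, ?_, ?_⟩
  · intro c hc d hd
    simp [(h c hc).2.1, (h d hd).2.2]
  · intro c hc
    simp [(h c hc).2.1]
  · intro c hc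
    simp [(h c hc).2.2]
  · intro c hc d hd
    simp [(h d hd).2.2]
  · intro d hd
    simp [(h d hd).1]
  · intro d hd
    simp [(h d hd).1]
  · intro c hc d hd
    simp [(h d hd).2.2]

/-- The auction: sufficiently many rounds of bids. -/
def auction : LoopProg := .seq auctionClear (.loop 50 3 (.loop 51 3 bidRound))

/-- Either the auction is over, or the prices have risen by `k`. -/
def Progress (k : ℕ) (s : State) : Prop :=
  AuctionState s ∧ ((∀ c < s.nat 0 0 0, ¬ Active s c) ∨ k ≤ totalPrice s)

theorem Progress.setNat {k : ℕ} {s : State} (h : Progress k s) {v : ℕ} (hv : 50 ≤ v) (x : ℕ) :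
    Progress k (s.setNat v 0 0 x) := by
  have hM : SameMatching s (s.setNat v 0 0 x) := by
    refine ⟨?_, ?_, ?_⟩ <;> funext a b <;> simp <;> omega
  have hG : SameGraph s (s.setNat v 0 0 x) := by
    refine ⟨?_, ?_, ?_, ?_⟩ <;> funext a b <;> simp <;> omega
  rwa [Progress, hM.auctionState hG, hM.totalPrice hG, hM.active hG, hG.1]

theorem Progress.bidRound {k : ℕ} {s : State} (h : Progress k s) :
    Progress (k + 1) (bidRound.run O s) := by
  obtain ⟨h1, h2⟩ := h
  obtain ⟨h3, h4⟩ := bidRound_spec (O := O) s h1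
  have hG := bidRound_sameGraph (O := O) s
  refine ⟨h3, ?_⟩
  rcases h4 with ⟨hM, hq⟩ | ⟨⟨c, hc, ha⟩, ht⟩
  · left
    rwa [hM.active hG, hG.1]
  · rcases h2 with h2 | h2
    · exact absurd ha (h2 c hc)
    · right
      omega

theorem bidRounds_spec {k : ℕ} {s : State} (h : Progress k s) :
    Progress (k + (s.nat 0 0 0 + 3)) ((LoopProg.loop 51 3 bidRound).run O s) := by
  refine LoopProg.loop_induction (fun i s' => Progress (k + i) s') ?_ h ?_
  · exact fun i s x h => h.setNat (by simp) x
  · exact fun i hi s' _ _ h => h.bidRound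

theorem AuctionState.totalPrice_le {s : State} (h : AuctionState s) :
    totalPrice s ≤ s.nat 0 0 0 * (s.nat 0 0 0 + 2) := by
  have := Finset.sum_le_card_nsmul (Finset.range (s.nat 0 0 0)) (fun d => s.nat 13 d 0) _
    (fun d hd => h.price_le d (Finset.mem_range.1 hd))
  simpa [totalPrice] using this

theorem auction_sameGraph (s : State) : SameGraph s (auction.run O s) := by
  refine sameGraph_of_frame (LoopProg.frame_run O auction s) ?_ ?_ ?_ ?_ <;>
    simp [LoopProg.natWrites, auction, auctionClear, bidRound, bidStep, bidBest, assign]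

theorem auction_spec (s : State) :
    AuctionState (auction.run O s) ∧
      Quiet (s.nat 0 0 0) (Edge s) (fun d => (auction.run O s).nat 13 d 0)
        (fun c => (auction.run O s).nat 14 (c + 1) 0) := by
  set s₁ := auctionClear.run O s with hs₁
  have e0 : s₁.nat 0 = s.nat 0 := LoopProg.run_nat (by simp [LoopProg.natWrites, auctionClear]) s
  have main := LoopProg.loop_induction (O := O) (v := 50) (c := 3) (p := .loop 51 3 bidRound)
    (s₀ := s₁) (fun i s' => Progress (i * (s.nat 0 0 0 + 3)) s')
    (fun i s x h => h.setNat (by simp) x)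
    ⟨auctionState_clear s, .inr (by simp)⟩
    (by
      intro i hi s' hF hv h
      have g0 := hF.1 0 (by simp [LoopProg.natWrites, bidRound, bidStep, bidBest, assign])
      have := bidRounds_spec (O := O) h
      rw [g0, e0] at this
      rwa [Nat.succ_mul])
  change Progress _ (auction.run O s) at main
  have hG := auction_sameGraph (O := O) s
  refine ⟨main.1, ?_⟩
  -- After `(n + 3) ^ 2` rounds the potential would exceed its bound `n * (n + 2)`.
  have hq := main.2.resolve_right (by
    have := main.1.totalPrice_le
    rw [hG.1] at this
    rw [e0]
    nlinarith)
  intro c hc d hd hfree hE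
  by_contra hlt
  exact hq c (by rwa [hG.1]) ⟨hfree, d, by rwa [hG.1], by rwa [hG.edge], by
    rw [hG.1]
    simpa using hlt⟩

/-! ### Construction of a set of facilities -/

/-- The facilities marked as opened. -/
def opened (s : State) : Finset ℕ :=
  (Finset.range (s.nat 0 0 0)).filter fun i => s.nat 16 (i + 1) 0 ≠ 0

theorem mem_opened {s : State} {i : ℕ} :
    i ∈ opened s ↔ i < s.nat 0 0 0 ∧ s.nat 16 (i + 1) 0 ≠ 0 := by
  simp [opened]

/-- Close all facilities and clear the error flag `0`. -/
def pickClear : LoopProg := .loop 9 1 (.setNat 16 (.var 9) (.const 0) (.const 0))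

theorem pickClear_spec (s : State) : ∀ x < s.nat 0 0 0 + 1, (pickClear.run O s).nat 16 x 0 = 0 := by
  refine LoopProg.loop_induction (fun n s' => ∀ x < n, s'.nat 16 x 0 = 0) ?_ ?_ ?_
  · intro i s x h
    simpa using h
  · simp
  · intro i hi s' hF hv h a ha
    simp [LoopProg.run, NExpr.eval, hv]
    intro
    exact h a (by omega)

/-- Here `f i` is a witness used directly as an address. Witnesses are successors of facilities, or
`0` for failure, so facility `i` is flagged in cell `i + 1` and a failed search raises the flag in
cell `0`. -/
theorem pick_spec {p : LoopProg} {P : ℕ → Prop} {f : ℕ → ℕ} (s : State)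
    (hp : ∀ i < s.nat 0 0 0, ∀ s', (LoopProg.loop 9 0 p).Frame s s' → s'.nat 9 0 0 = i → ∀ x,
      (p.run O s').nat 16 x 0 ≠ 0 ↔ s'.nat 16 x 0 ≠ 0 ∨ (P i ∧ f i = x)) :
    ∀ x, ((LoopProg.loop 9 0 p).run O s).nat 16 x 0 ≠ 0 ↔
      s.nat 16 x 0 ≠ 0 ∨ ∃ i < s.nat 0 0 0, P i ∧ f i = x := by
  refine LoopProg.loop_induction (c := 0) (fun n s' => ∀ x, s'.nat 16 x 0 ≠ 0 ↔
      s.nat 16 x 0 ≠ 0 ∨ ∃ i < n, P i ∧ f i = x) ?_ ?_ ?_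
  · intro i s x h
    simpa using h
  · simp
  · intro i hi s' hF hv h x
    rw [hp i hi s' hF hv x, h x, or_assoc]
    refine or_congr_right ⟨?_, ?_⟩
    · rintro (⟨j, hj, h⟩ | h)
      · exact ⟨j, by omega, h⟩
      · exact ⟨i, by omega, h⟩
    · rintro ⟨j, hj, hPj⟩
      rcases Nat.lt_succ_iff_lt_or_eq.1 hj with hj | rfl
      · exact .inl ⟨j, hj, hPj⟩
      · exact .inr hPj

/-- Open a facility for every free client of the first metric. -/
def pickLeft : LoopProg :=
  .loop 9 0 (.ite (.conj (.nonzero (.arr 20 (.var 9)))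
      (.natLe (.arr 14 (.add (.var 9) (.const 1))) (.const 0)))
    (.setNat 16 (.get 40 (.var 9) (.var 9)) (.const 0) (.const 1)) .skip)

theorem pickLeft_spec (s : State) : ∀ x, (pickLeft.run O s).nat 16 x 0 ≠ 0 ↔
    s.nat 16 x 0 ≠ 0 ∨ ∃ c < s.nat 0 0 0, (s.nat 20 c 0 ≠ 0 ∧ s.nat 14 (c + 1) 0 = 0) ∧
      s.nat 40 c c = x := by
  refine pick_spec s ?_
  intro i hi s' hF hv x
  have e14 := hF.1 14 (by simp [LoopProg.natWrites])
  have e20 := hF.1 20 (by simp [LoopProg.natWrites])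
  have e40 := hF.1 40 (by simp [LoopProg.natWrites])
  by_cases hc : s.nat 20 i 0 ≠ 0 ∧ s.nat 14 (i + 1) 0 = 0
  · simp [LoopProg.run, Guard.Holds, NExpr.eval, hv, e14, e20, e40, hc]
    grind
  · have : (LoopProg.ite (.conj (.nonzero (.arr 20 (.var 9)))
        (.natLe (.arr 14 (.add (.var 9) (.const 1))) (.const 0)))
        (.setNat 16 (.get 40 (.var 9) (.var 9)) (.const 0) (.const 1)) .skip).run O s' = s' := by
      rw [LoopProg.run, if_neg]
      · rfl
      · simpa [Guard.Holds, NExpr.eval, hv, e14, e20] using hc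
    rw [this]
    simp [hc]

/-- The successor of a facility for the client `d` of the second metric, which serves its mate,
too, if there is one. -/
def pickedRight (s : State) (d : ℕ) : ℕ :=
  if s.nat 15 d 0 = 0 then s.nat 41 d d else s.nat 19 (s.nat 15 d 0 - 1) d

/-- Open a facility for every selected client of the second metric and its mate. -/
def pickRight : LoopProg :=
  .loop 9 0 (.ite (.nonzero (.arr 21 (.var 9)))
    (.ite (.natLe (.arr 15 (.var 9)) (.const 0))
      (.setNat 16 (.get 41 (.var 9) (.var 9)) (.const 0) (.const 1))
      (.setNat 16 (.get 19 (.sub (.arr 15 (.var 9)) (.const 1)) (.var 9)) (.const 0) (.const 1)))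
    .skip)

theorem pickRight_spec (s : State) : ∀ x, (pickRight.run O s).nat 16 x 0 ≠ 0 ↔
    s.nat 16 x 0 ≠ 0 ∨ ∃ d < s.nat 0 0 0, s.nat 21 d 0 ≠ 0 ∧ pickedRight s d = x := by
  refine pick_spec s ?_
  intro i hi s' hF hv x
  have e15 := hF.1 15 (by simp [LoopProg.natWrites])
  have e19 := hF.1 19 (by simp [LoopProg.natWrites])
  have e21 := hF.1 21 (by simp [LoopProg.natWrites])
  have e41 := hF.1 41 (by simp [LoopProg.natWrites])
  by_cases h1 : s.nat 21 i 0 = 0 <;> by_cases h2 : s.nat 15 i 0 = 0 <;>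
    simp [LoopProg.run, Guard.Holds, NExpr.eval, hv, e15, e19, e21, e41, h1, h2, pickedRight]
  all_goals grind

/-- Count the opened facilities. -/
def count : LoopProg :=
  .seq (.setNat 17 (.const 0) (.const 0) (.const 0)) <|
  .loop 9 0 (.ite (.nonzero (.arr 16 (.add (.var 9) (.const 1))))
    (.setNat 17 (.const 0) (.const 0) (.add (.var 17) (.const 1))) .skip)

theorem count_spec (s : State) : (count.run O s).nat 17 0 0 = (opened s).card := by
  have := LoopProg.loop_induction (O := O) (v := 9) (c := 0) (s₀ := s.setNat 17 0 0 0)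
    (p := .ite (.nonzero (.arr 16 (.add (.var 9) (.const 1))))
    (.setNat 17 (.const 0) (.const 0) (.add (.var 17) (.const 1))) .skip)
    (fun n s' => s'.nat 17 0 0 =
      ((Finset.range n).filter fun i => s.nat 16 (i + 1) 0 ≠ 0).card)
    (by
      intro i s x h
      simpa using h)
    (by simp)
    (by
      intro i hi s' hF hv h
      have e16 : s'.nat 16 (i + 1) 0 = s.nat 16 (i + 1) 0 := by
        rw [hF.1 16 (by simp [LoopProg.natWrites])]
        simp
      rw [Finset.range_add_one, Finset.filter_insert]
      by_cases hc : s.nat 16 (i + 1) 0 = 0 <;>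
        simp [LoopProg.run, Guard.Holds, NExpr.eval, hv, e16, hc, h])
  simpa [count, LoopProg.run, NExpr.eval, opened] using this

/-- Open further facilities as long as there are fewer than `k`. -/
def pad : LoopProg :=
  .loop 9 0 (.ite (.conj (.nonzero (.arr 2 (.var 9)))
      (.conj (.natLe (.arr 16 (.add (.var 9) (.const 1))) (.const 0))
        (.natLe (.add (.var 17) (.const 1)) (.var 1))))
    (.seq (.setNat 16 (.add (.var 9) (.const 1)) (.const 0) (.const 1))
      (.setNat 17 (.const 0) (.const 0) (.add (.var 17) (.const 1)))) .skip)

/-- What holds after looking at the first `m` points for further facilities. -/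
structure PadInv (s : State) (m : ℕ) (s' : State) : Prop where
  count : s'.nat 17 0 0 = (opened s').card
  flag : s'.nat 16 0 0 = s.nat 16 0 0
  subset : opened s ⊆ opened s'
  facility : ∀ i ∈ opened s', i ∈ opened s ∨ s.nat 2 i 0 ≠ 0
  le : s.nat 17 0 0 ≤ s.nat 1 0 0 → s'.nat 17 0 0 ≤ s.nat 1 0 0
  full : s.nat 1 0 0 ≤ s'.nat 17 0 0 ∨ ∀ i < m, s.nat 2 i 0 ≠ 0 → i ∈ opened s'

theorem pad_spec (s : State) (h : s.nat 17 0 0 = (opened s).card) :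
    PadInv s (s.nat 0 0 0) (pad.run O s) := by
  refine LoopProg.loop_induction (c := 0) (fun n s' => PadInv s n s') ?_ ?_ ?_
  · intro i s' x h
    have e : opened (s'.setNat 9 0 0 x) = opened s' := by simp [opened]
    exact ⟨by simpa [e] using h.count, by simpa using h.flag, e ▸ h.subset, e ▸ h.facility,
      by simpa using h.le, by simpa [e] using h.full⟩
  · exact ⟨h, rfl, subset_rfl, fun _ => .inl, id, .inr (by simp)⟩
  · intro i hi s' hF hv h
    have e0 := hF.1 0 (by simp [LoopProg.natWrites])
    have e1 := hF.1 1 (by simp [LoopProg.natWrites])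
    have e2 := hF.1 2 (by simp [LoopProg.natWrites])
    rw [LoopProg.run]
    split_ifs with hc
    · simp [Guard.Holds, NExpr.eval, hv, e1, e2] at hc
      obtain ⟨h1, h2, h3⟩ := hc
      simp [LoopProg.run, NExpr.eval, hv]
      have hop : opened ((s'.setNat 16 (i + 1) 0 1).setNat 17 0 0 (s'.nat 17 0 0 + 1)) =
          insert i (opened s') := by
        ext j
        simp only [mem_opened, Finset.mem_insert, State.setNat_nat, e0]
        simp
        by_cases hj : j = i <;> simp [hj]
        omega
      have hi' : i ∉ opened s' := by simp [mem_opened, h2]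
      refine ⟨?_, ?_, ?_, ?_, ?_, ?_⟩
      · rw [hop, Finset.card_insert_of_notMem hi', ← h.count]
        simp
      · simpa using h.flag
      · exact hop ▸ h.subset.trans (Finset.subset_insert _ _)
      · intro j hj
        rw [hop, Finset.mem_insert] at hj
        rcases hj with rfl | hj
        · exact .inr h1
        · exact h.facility j hj
      · simp
        intro _
        omega
      · rw [hop]
        simp
        refine h.full.imp (fun _ => by omega) fun hf j hj hFj => ?_
        rcases Nat.lt_succ_iff_lt_or_eq.1 (Nat.lt_succ_of_le hj) with hj | rfl
        · exact .inr (hf j hj hFj)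
        · exact .inl rfl
    · simp only [LoopProg.run]
      refine ⟨h.count, h.flag, h.subset, h.facility, h.le, ?_⟩
      refine or_iff_not_imp_left.2 fun hk j hj hFj => ?_
      rcases Nat.lt_succ_iff_lt_or_eq.1 hj with hj | rfl
      · exact h.full.resolve_left hk j hj hFj
      · rw [mem_opened, e0]
        refine ⟨hi, fun h0 => hc ?_⟩
        simp [Guard.Holds, NExpr.eval, hv, e1, e2, h0]
        omega

/-- Open facilities for all selected clients, and further ones if there are fewer than `k`. -/
def construct : LoopProg := .seq pickClear <| .seq pickLeft <| .seq pickRight <| .seq count pad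

/-- The numbers that are opened for some selected client; `0` stands for a failure. -/
def Picked (s : State) (x : ℕ) : Prop :=
  (∃ c < s.nat 0 0 0, (s.nat 20 c 0 ≠ 0 ∧ s.nat 14 (c + 1) 0 = 0) ∧ s.nat 40 c c = x) ∨
    ∃ d < s.nat 0 0 0, s.nat 21 d 0 ≠ 0 ∧ pickedRight s d = x

/-- The selected clients of metric `t`. -/
def selected (t : ℕ) (s : State) : Finset ℕ :=
  (Finset.range (s.nat 0 0 0)).filter fun a => s.nat (t + 20) a 0 ≠ 0

/-- Matched clients of the first metric cost nothing extra, because the facility of the mate serves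
them too. Coincidences among the picked facilities only lower the count. -/
theorem card_picked_le (s : State) (U : Finset ℕ) (hU : ∀ i ∈ U, Picked s (i + 1)) :
    U.card ≤ ((selected 0 s).filter fun c => s.nat 14 (c + 1) 0 = 0).card +
      (selected 1 s).card := by
  classical
  calc U.card = (U.image (· + 1)).card := (Finset.card_image_of_injective _ fun a b h => by
        simpa using h).symm
    _ ≤ (((selected 0 s).filter fun c => s.nat 14 (c + 1) 0 = 0).image (fun c => s.nat 40 c c) ∪
        (selected 1 s).image (pickedRight s)).card := by
      refine Finset.card_le_card fun x hx => ?_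
      obtain ⟨i, hi, rfl⟩ := Finset.mem_image.1 hx
      rw [Finset.mem_union, Finset.mem_image, Finset.mem_image]
      rcases hU i hi with ⟨c, hc, ⟨h1, h2⟩, h3⟩ | ⟨d, hd, h1, h2⟩
      · exact .inl ⟨c, by simp [selected, hc, h1, h2], h3⟩
      · exact .inr ⟨d, by simp [selected, hd, h1], h2⟩
    _ ≤ _ := (Finset.card_union_le _ _).trans
      (Nat.add_le_add Finset.card_image_le Finset.card_image_le)

/-- Completeness of the test needs only the failure flag and the implication bounding the number of
opened facilities; soundness needs all the other parts. -/
theorem construct_spec (s : State) :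
    ((construct.run O s).nat 16 0 0 ≠ 0 ↔ Picked s 0) ∧
    (∀ i < s.nat 0 0 0, Picked s (i + 1) → i ∈ opened (construct.run O s)) ∧
    (construct.run O s).nat 17 0 0 = (opened (construct.run O s)).card ∧
    (∀ i ∈ opened (construct.run O s), Picked s (i + 1) ∨ s.nat 2 i 0 ≠ 0) ∧
    (((selected 0 s).filter fun c => s.nat 14 (c + 1) 0 = 0).card + (selected 1 s).card ≤
      s.nat 1 0 0 → (construct.run O s).nat 17 0 0 ≤ s.nat 1 0 0) ∧
    (s.nat 1 0 0 ≤ (construct.run O s).nat 17 0 0 ∨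
      ∀ i < s.nat 0 0 0, s.nat 2 i 0 ≠ 0 → i ∈ opened (construct.run O s)) := by
  set s₁ := pickClear.run O s with hs₁
  set s₂ := pickLeft.run O s₁ with hs₂
  set s₃ := pickRight.run O s₂ with hs₃
  set s₄ := count.run O s₃ with hs₄
  have hrun : construct.run O s = pad.run O s₄ := rfl
  have e₁ : ∀ a, a ≠ 9 → a ≠ 16 → s₁.nat a = s.nat a := fun a h1 h2 =>
    LoopProg.run_nat (by simp [LoopProg.natWrites, pickClear, h1, h2]) s
  have e₂ : ∀ a, a ≠ 9 → a ≠ 16 → s₂.nat a = s.nat a := fun a h1 h2 => by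
    rw [← e₁ a h1 h2]
    exact LoopProg.run_nat (by simp [LoopProg.natWrites, pickLeft, h1, h2]) s₁
  have e₃ : ∀ a, a ≠ 9 → a ≠ 16 → s₃.nat a = s.nat a := fun a h1 h2 => by
    rw [← e₂ a h1 h2]
    exact LoopProg.run_nat (by simp [LoopProg.natWrites, pickRight, h1, h2]) s₂
  have f₄ : ∀ a, a ≠ 9 → a ≠ 17 → s₄.nat a = s₃.nat a := fun a h1 h2 =>
    LoopProg.run_nat (by simp [LoopProg.natWrites, count, h1, h2]) s₃
  have e₄ : ∀ a, a ≠ 9 → a ≠ 16 → a ≠ 17 → s₄.nat a = s.nat a := fun a h1 h2 h3 => by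
    rw [f₄ a h1 h3, e₃ a h1 h2]
  have hp : ∀ x < s.nat 0 0 0 + 1, s₃.nat 16 x 0 ≠ 0 ↔ Picked s x := by
    intro x hx
    have hr : ∀ d, pickedRight s₂ d = pickedRight s d := by
      intro d
      simp [pickedRight, e₂]
    rw [hs₃, pickRight_spec, hs₂, pickLeft_spec, ← hs₂, hs₁, pickClear_spec s x hx, ← hs₁]
    simp only [ne_eq, not_true_eq_false, false_or, hr, Picked]
    simp only [e₁ 0 (by simp) (by simp), e₁ 20 (by simp) (by simp), e₁ 14 (by simp) (by simp),
      e₁ 40 (by simp) (by simp), e₂ 0 (by simp) (by simp), e₂ 21 (by simp) (by simp)]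
  have ho : opened s₄ = opened s₃ := by simp [opened, f₄]
  have hm : ∀ i, i ∈ opened s₄ ↔ i < s.nat 0 0 0 ∧ Picked s (i + 1) := by
    intro i
    rw [ho, mem_opened, e₃ 0 (by simp) (by simp)]
    exact and_congr_right fun hi => hp (i + 1) (by omega)
  have h17 : s₄.nat 17 0 0 = (opened s₄).card := by rw [ho, hs₄, count_spec]
  have hpad := pad_spec (O := O) s₄ h17
  have c0 := e₄ 0 (by simp) (by simp) (by simp)
  have c1 := e₄ 1 (by simp) (by simp) (by simp)
  have c2 := e₄ 2 (by simp) (by simp) (by simp)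
  rw [hrun]
  refine ⟨?_, ?_, hpad.count, ?_, ?_, ?_⟩
  · rw [hpad.flag, f₄ 16 (by simp) (by simp), hp 0 (by omega)]
  · exact fun i hi hP => hpad.subset ((hm i).2 ⟨hi, hP⟩)
  · intro i hi
    rw [← c2]
    exact (hpad.facility i hi).imp_left fun h => ((hm i).1 h).2
  · intro hk
    rw [← c1]
    refine hpad.le ?_
    rw [h17, c1]
    exact (card_picked_le s _ fun i hi => ((hm i).1 hi).2).trans hk
  · rw [← c0, ← c1, ← c2]
    exact hpad.full

/-! ### Testing a guess -/

/-- The balls of two clients have a common facility. -/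
def Meets (s : State) (t u a b : ℕ) : Prop := ∃ i < s.nat 0 0 0, Ball s t a i ∧ Ball s u b i

theorem Meets.symm {s : State} {t u a b : ℕ} (h : Meets s t u a b) : Meets s u t b a := by
  obtain ⟨i, hi, h1, h2⟩ := h
  exact ⟨i, hi, h2, h1⟩

/-- The selection of clients and the matching between them. -/
def prepare : LoopProg :=
  .seq (meet 0 0 21) <| .seq (meet 1 1 22) <| .seq (meet 0 1 0) <| .seq (greedy 0) <|
    .seq (greedy 1) auction

/-- The result `s'` of `prepare` in state `s`. -/
structure Prepared (s s' : State) : Prop where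
  input : ∀ a < 4, s'.nat a = s.nat a
  witness₁ : ∀ a < s.nat 0 0 0, ∀ b < s.nat 0 0 0,
    Witness (s.nat 0 0 0) (fun i => Ball s 0 a i ∧ Ball s 0 b i) (s'.nat 40 a b)
  witness₂ : ∀ a < s.nat 0 0 0, ∀ b < s.nat 0 0 0,
    Witness (s.nat 0 0 0) (fun i => Ball s 1 a i ∧ Ball s 1 b i) (s'.nat 41 a b)
  witness : ∀ a < s.nat 0 0 0, ∀ b < s.nat 0 0 0,
    Witness (s.nat 0 0 0) (fun i => Ball s 0 a i ∧ Ball s 1 b i) (s'.nat 19 a b)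
  greedy₁ : GreedyState 0 (Meets s 0 0) s'
  greedy₂ : GreedyState 1 (Meets s 1 1) s'
  covered₁ : ∀ b < s.nat 0 0 0, s.nat 3 b 0 ≠ 0 → s'.nat 30 b 0 ≠ 0
  covered₂ : ∀ b < s.nat 0 0 0, s.nat 3 b 0 ≠ 0 → s'.nat 31 b 0 ≠ 0
  auction : AuctionState s'
  quiet : Quiet (s'.nat 0 0 0) (Edge s') (fun d => s'.nat 13 d 0) (fun c => s'.nat 14 (c + 1) 0)

theorem not_mem_natWrites_meet {t u y a : ℕ} (h1 : a ≠ 9) (h2 : a ≠ 10) (h3 : a ≠ 11)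
    (h4 : a ≠ y + 19) : a ∉ (meet t u y).natWrites := by
  simp [LoopProg.natWrites, meet, meetRow, meetSearch, h1, h2, h3, h4]

theorem not_mem_natWrites_greedy {t a : ℕ} (h1 : a ≠ 9) (h2 : a ≠ 10) (h3 : a ≠ 12)
    (h4 : a ≠ t + 20) (h5 : a ≠ t + 30) : a ∉ (greedy t).natWrites := by
  simp [LoopProg.natWrites, greedy, greedyClear, greedyRound, greedyBest, greedyMark,
    h1, h2, h3, h4, h5]

theorem not_mem_natWrites_auction {a : ℕ} (h : a ∉ [9, 10, 12, 13, 14, 15, 50, 51]) :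
    a ∉ auction.natWrites := by
  simp at h
  simp [LoopProg.natWrites, auction, auctionClear, bidRound, bidStep, bidBest, assign, h]

theorem realWrites_prepare : prepare.realWrites = [] := by
  simp [LoopProg.realWrites, prepare, meet, meetRow, meetSearch, greedy, greedyClear, greedyRound,
    greedyBest, greedyMark, auction, auctionClear, bidRound, bidStep, bidBest, assign]

theorem realWrites_meet (t u y : ℕ) : (meet t u y).realWrites = [] := by
  simp [LoopProg.realWrites, meet, meetRow, meetSearch]

theorem realWrites_greedy (t : ℕ) : (greedy t).realWrites = [] := by
  simp [LoopProg.realWrites, greedy, greedyClear, greedyRound, greedyBest, greedyMark]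

theorem realWrites_auction : auction.realWrites = [] := by
  simp [LoopProg.realWrites, auction, auctionClear, bidRound, bidStep, bidBest, assign]

theorem GreedyState.congr {t : ℕ} {M : ℕ → ℕ → Prop} {s s' : State} (h : GreedyState t M s)
    (h0 : s'.nat 0 = s.nat 0) (h3 : s'.nat 3 = s.nat 3) (hR : s'.real = s.real)
    (hS : s'.nat (t + 20) = s.nat (t + 20)) (hC : s'.nat (t + 30) = s.nat (t + 30)) :
    GreedyState t M s' := by
  rw [GreedyState, h0, h3, hR, hS, hC]
  exact h

/-- Bookkeeping only: no phase overwrites the input or the results of an earlier phase that are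
still needed, so every specification carries over to the final state. -/
theorem prepare_spec (s : State) : Prepared s (prepare.run O s) := by
  set s₁ := (meet 0 0 21).run O s with hs₁
  set s₂ := (meet 1 1 22).run O s₁ with hs₂
  set s₃ := (meet 0 1 0).run O s₂ with hs₃
  set s₄ := (greedy 0).run O s₃ with hs₄
  set s₅ := (greedy 1).run O s₄ with hs₅
  set s₆ := auction.run O s₅ with hs₆
  have hrun : prepare.run O s = s₆ := by
    simp only [prepare, LoopProg.run_seq, s₆, s₅, s₄, s₃, s₂, s₁]
  have r₁ : s₁.real = s.real := (LoopProg.frame_run O _ s).real_eq (realWrites_meet _ _ _)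
  have r₂ : s₂.real = s.real :=
    ((LoopProg.frame_run O _ s₁).real_eq (realWrites_meet _ _ _)).trans r₁
  have r₃ : s₃.real = s.real :=
    ((LoopProg.frame_run O _ s₂).real_eq (realWrites_meet _ _ _)).trans r₂
  have r₄ : s₄.real = s.real :=
    ((LoopProg.frame_run O _ s₃).real_eq (realWrites_greedy _)).trans r₃
  have r₅ : s₅.real = s.real :=
    ((LoopProg.frame_run O _ s₄).real_eq (realWrites_greedy _)).trans r₄
  have r₆ : s₆.real = s₅.real := (LoopProg.frame_run O _ s₅).real_eq realWrites_auction
  have n₁ : ∀ a, a ≠ 9 → a ≠ 10 → a ≠ 11 → a ≠ 40 → s₁.nat a = s.nat a :=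
    fun a h1 h2 h3 h4 => LoopProg.run_nat (not_mem_natWrites_meet h1 h2 h3 h4) s
  have n₂ : ∀ a, a ≠ 9 → a ≠ 10 → a ≠ 11 → a ≠ 41 → s₂.nat a = s₁.nat a :=
    fun a h1 h2 h3 h4 => LoopProg.run_nat (not_mem_natWrites_meet h1 h2 h3 h4) s₁
  have n₃ : ∀ a, a ≠ 9 → a ≠ 10 → a ≠ 11 → a ≠ 19 → s₃.nat a = s₂.nat a :=
    fun a h1 h2 h3 h4 => LoopProg.run_nat (not_mem_natWrites_meet h1 h2 h3 h4) s₂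
  have n₄ : ∀ a, a ≠ 9 → a ≠ 10 → a ≠ 12 → a ≠ 20 → a ≠ 30 → s₄.nat a = s₃.nat a :=
    fun a h1 h2 h3 h4 h5 => LoopProg.run_nat (not_mem_natWrites_greedy h1 h2 h3 h4 h5) s₃
  have n₅ : ∀ a, a ≠ 9 → a ≠ 10 → a ≠ 12 → a ≠ 21 → a ≠ 31 → s₅.nat a = s₄.nat a :=
    fun a h1 h2 h3 h4 h5 => LoopProg.run_nat (not_mem_natWrites_greedy h1 h2 h3 h4 h5) s₄
  have n₆ : ∀ a, a ∉ [9, 10, 12, 13, 14, 15, 50, 51] → s₆.nat a = s₅.nat a :=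
    fun a h => LoopProg.run_nat (not_mem_natWrites_auction h) s₅
  have i₁ : ∀ a < 4, s₁.nat a = s.nat a := fun a h =>
    n₁ a (by omega) (by omega) (by omega) (by omega)
  have i₂ : ∀ a < 4, s₂.nat a = s.nat a := fun a h =>
    (n₂ a (by omega) (by omega) (by omega) (by omega)).trans (i₁ a h)
  have i₃ : ∀ a < 4, s₃.nat a = s.nat a := fun a h =>
    (n₃ a (by omega) (by omega) (by omega) (by omega)).trans (i₂ a h)
  have i₄ : ∀ a < 4, s₄.nat a = s.nat a := fun a h =>
    (n₄ a (by omega) (by omega) (by omega) (by omega) (by omega)).trans (i₃ a h)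
  have i₅ : ∀ a < 4, s₅.nat a = s.nat a := fun a h =>
    (n₅ a (by omega) (by omega) (by omega) (by omega) (by omega)).trans (i₄ a h)
  have i₆ : ∀ a < 4, s₆.nat a = s.nat a := fun a h =>
    (n₆ a (by simp; omega)).trans (i₅ a h)
  have w₁ := meet_spec (O := O) 0 0 21 s
  have w₂ := meet_spec (O := O) 1 1 22 s₁
  have w₃ := meet_spec (O := O) 0 1 0 s₂
  rw [Ball.congr (i₁ 2 (by simp)) r₁, i₁ 0 (by simp)] at w₂
  rw [Ball.congr (i₂ 2 (by simp)) r₂, i₂ 0 (by simp)] at w₃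
  rw [← hs₁] at w₁
  rw [← hs₂] at w₂
  rw [← hs₃] at w₃
  norm_num at w₁ w₂ w₃
  have e40 : s₃.nat 40 = s₁.nat 40 := by
    rw [n₃ 40 (by simp) (by simp) (by simp) (by simp), n₂ 40 (by simp) (by simp) (by simp) (by simp)]
  have e41 : s₃.nat 41 = s₂.nat 41 := n₃ 41 (by simp) (by simp) (by simp) (by simp)
  have f40 : s₆.nat 40 = s₃.nat 40 := by
    rw [n₆ 40 (by simp), n₅ 40 (by simp) (by simp) (by simp) (by simp) (by simp),
      n₄ 40 (by simp) (by simp) (by simp) (by simp) (by simp)]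
  have f41 : s₆.nat 41 = s₃.nat 41 := by
    rw [n₆ 41 (by simp), n₅ 41 (by simp) (by simp) (by simp) (by simp) (by simp),
      n₄ 41 (by simp) (by simp) (by simp) (by simp) (by simp)]
  have f19 : s₆.nat 19 = s₃.nat 19 := by
    rw [n₆ 19 (by simp), n₅ 19 (by simp) (by simp) (by simp) (by simp) (by simp),
      n₄ 19 (by simp) (by simp) (by simp) (by simp) (by simp)]
  obtain ⟨g₁, c₁⟩ := greedy_spec (O := O) 0 (M := Meets s 0 0) (fun a b h => h.symm) s₃ (by
    intro a ha b hb
    rw [i₃ 0 (by simp)] at ha hb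
    change s₃.nat 40 a b ≠ 0 ↔ _
    rw [e40]
    exact (w₁ a ha b hb).ne_zero_iff)
  obtain ⟨g₂, c₂⟩ := greedy_spec (O := O) 1 (M := Meets s 1 1) (fun a b h => h.symm) s₄ (by
    intro a ha b hb
    rw [i₄ 0 (by simp)] at ha hb
    change s₄.nat 41 a b ≠ 0 ↔ _
    rw [n₄ 41 (by simp) (by simp) (by simp) (by simp) (by simp), e41]
    exact (w₂ a ha b hb).ne_zero_iff)
  obtain ⟨au, qu⟩ := auction_spec (O := O) s₅
  rw [← hs₄] at g₁ c₁
  rw [← hs₅] at g₂ c₂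
  rw [hrun]
  refine ⟨i₆, ?_, ?_, ?_, ?_, ?_, ?_, ?_, au, ?_⟩
  · rw [f40, e40]
    exact w₁
  · rw [f41, e41]
    exact w₂
  · rw [f19]
    exact w₃
  · refine g₁.congr ?_ ?_ (r₆.trans (r₅.trans r₄.symm)) ?_ ?_
    · rw [i₆ 0 (by simp), i₄ 0 (by simp)]
    · rw [i₆ 3 (by simp), i₄ 3 (by simp)]
    · rw [n₆ _ (by simp), n₅ _ (by simp) (by simp) (by simp) (by simp) (by simp)]
    · rw [n₆ _ (by simp), n₅ _ (by simp) (by simp) (by simp) (by simp) (by simp)]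
  · refine g₂.congr ?_ ?_ r₆ ?_ ?_
    · rw [i₆ 0 (by simp), i₅ 0 (by simp)]
    · rw [i₆ 3 (by simp), i₅ 3 (by simp)]
    · rw [n₆ _ (by simp)]
    · rw [n₆ _ (by simp)]
  · intro b hb hC
    rw [n₆ 30 (by simp), n₅ 30 (by simp) (by simp) (by simp) (by simp) (by simp)]
    exact c₁ b (by rwa [i₃ 0 (by simp)]) (by rwa [i₃ 3 (by simp)])
  · intro b hb hC
    rw [n₆ 31 (by simp)]
    exact c₂ b (by rwa [i₄ 0 (by simp)]) (by rwa [i₄ 3 (by simp)])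
  · have hG := auction_sameGraph (O := O) s₅
    rw [hG.1, hG.edge]
    exact qu

/-- Find a set of facilities for the guessed costs. -/
def solve : LoopProg := .seq prepare construct

/-- A free client has a facility of its own, the witness on the diagonal. A matched one relies on
its mate `d`, for which a common facility of both balls was picked; it exists because matched pairs
are edges. -/
theorem Prepared.exists_ball₁ {s s' : State} (h : Prepared s s') (hP : ¬ Picked s' 0) {a : ℕ}
    (ha : a < s.nat 0 0 0) (hs : s'.nat 20 a 0 ≠ 0) :
    ∃ i < s.nat 0 0 0, Ball s 0 a i ∧ Picked s' (i + 1) := by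
  have e0 := h.input 0 (by simp)
  by_cases hf : s'.nat 14 (a + 1) 0 = 0
  · rcases h.witness₁ a ha a ha with ⟨h1, _⟩ | ⟨i, hi, h1, h2, _⟩
    · exact absurd (.inl ⟨a, by rwa [e0], ⟨hs, hf⟩, h1⟩) hP
    · exact ⟨i, hi, h2, .inl ⟨a, by rwa [e0], ⟨hs, hf⟩, h1⟩⟩
  · have hle := h.auction.left_le a (by rwa [e0])
    simp only [e0] at hle
    obtain ⟨d, hd⟩ := Nat.exists_eq_succ_of_ne_zero hf
    have hdn : d < s.nat 0 0 0 := by omega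
    have hm := (h.auction.mate_iff a (by rwa [e0]) d (by rwa [e0])).1 hd
    have hE := h.auction.edge a (by rwa [e0]) d (by rwa [e0]) hm
    have hpick : pickedRight s' d = s'.nat 19 a d := by simp [pickedRight, hm]
    rcases h.witness a ha d hdn with ⟨h1, _⟩ | ⟨i, hi, h1, h2, _⟩
    · exact absurd h1 hE.2.2
    · exact ⟨i, hi, h2, .inr ⟨d, by rwa [e0], hE.2.1, by rw [hpick, h1]⟩⟩

theorem Prepared.exists_ball₂ {s s' : State} (h : Prepared s s') (hP : ¬ Picked s' 0) {d : ℕ}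
    (hd : d < s.nat 0 0 0) (hs : s'.nat 21 d 0 ≠ 0) :
    ∃ i < s.nat 0 0 0, Ball s 1 d i ∧ Picked s' (i + 1) := by
  have e0 := h.input 0 (by simp)
  by_cases hf : s'.nat 15 d 0 = 0
  · have hpick : pickedRight s' d = s'.nat 41 d d := by simp [pickedRight, hf]
    rcases h.witness₂ d hd d hd with ⟨h1, _⟩ | ⟨i, hi, h1, h2, _⟩
    · exact absurd (.inr ⟨d, by rwa [e0], hs, by rw [hpick, h1]⟩) hP
    · exact ⟨i, hi, h2, .inr ⟨d, by rwa [e0], hs, by rw [hpick, h1]⟩⟩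
  · have hle := h.auction.right_le d (by rwa [e0])
    simp only [e0] at hle
    have hcn : s'.nat 15 d 0 - 1 < s.nat 0 0 0 := by omega
    have hpick : pickedRight s' d = s'.nat 19 (s'.nat 15 d 0 - 1) d := by simp [pickedRight, hf]
    rcases h.witness _ hcn d hd with ⟨h1, _⟩ | ⟨i, hi, h1, _, h2⟩
    · exact absurd (.inr ⟨d, by rwa [e0], hs, by rw [hpick, h1]⟩) hP
    · exact ⟨i, hi, h2, .inr ⟨d, by rwa [e0], hs, by rw [hpick, h1]⟩⟩

theorem picked_facility {s s' : State} (h : Prepared s s') {i : ℕ} (hP : Picked s' (i + 1)) :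
    s.nat 2 i 0 ≠ 0 := by
  have e0 := h.input 0 (by simp)
  have hW : ∀ {P : ℕ → Prop}, Witness (s.nat 0 0 0) P (i + 1) → P i := by
    rintro P (⟨h1, _⟩ | ⟨j, _, h1, h2⟩)
    · omega
    · obtain rfl : i = j := by omega
      exact h2
  rcases hP with ⟨c, hc, _, h1⟩ | ⟨d, hd, _, h1⟩
  · rw [e0] at hc
    have := h.witness₁ c hc c hc
    rw [h1] at this
    exact (hW this).1.1
  · rw [pickedRight] at h1
    split_ifs at h1 with hf
    · rw [e0] at hd
      have := h.witness₂ d hd d hd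
      rw [h1] at this
      exact (hW this).1.1
    · have hle := h.auction.right_le d hd
      simp only [e0] at hle hd
      have := h.witness (s'.nat 15 d 0 - 1) (by omega) d hd
      rw [h1] at this
      exact (hW this).1.1

/-- The distances and weights of metric `t`, as stored in the memory, are those of an instance. -/
structure MetricState (s : State) (t : ℕ) : Prop where
  symm : ∀ u < s.nat 0 0 0, ∀ v < s.nat 0 0 0, s.real (2 * t) u v = s.real (2 * t) v u
  triangle : ∀ u < s.nat 0 0 0, ∀ v < s.nat 0 0 0, ∀ x < s.nat 0 0 0,
    s.real (2 * t) u x ≤ s.real (2 * t) u v + s.real (2 * t) v x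
  dist_nonneg : ∀ u v, 0 ≤ s.real (2 * t) u v
  weight_nonneg : ∀ u, 0 ≤ s.real (2 * t + 1) u 0

/-- With `x` a common facility of the balls of `a` and `b`, walk from `b` via `x` and `a` to `i`.
Each leg costs at most the guess; on the legs at `a` the weight of `b` may be replaced by the larger
weight of `a`, which is why the greedy order is by descending weight. -/
theorem MetricState.three_mul {s : State} {t : ℕ} (h : MetricState s t) {a b i : ℕ}
    (ha : a < s.nat 0 0 0) (hb : b < s.nat 0 0 0) (hi : i < s.nat 0 0 0) (hB : Ball s t a i)
    (hw : s.real (2 * t + 1) b 0 ≤ s.real (2 * t + 1) a 0) (hab : b = a ∨ Meets s t t a b) :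
    s.real (2 * t + 1) b 0 * s.real (2 * t) b i ≤ 3 * s.real 4 t 0 := by
  have hai := hB.2
  -- The guess is nonnegative, as its ball is nonempty; this is needed to pass from factor `1` to
  -- `3` when `b = a`.
  have hr := (mul_nonneg (h.weight_nonneg a) (h.dist_nonneg a i)).trans hai
  rcases hab with rfl | ⟨x, hx, hax, hbx⟩
  · linarith
  · have hax := hax.2
    have hbx := hbx.2
    have t1 := h.triangle b hb x hx i hi
    have t2 := h.triangle x hx a ha i hi
    rw [h.symm x hx a ha] at t2
    have hwb := h.weight_nonneg b
    have m1 := mul_le_mul_of_nonneg_left (t1.trans (add_le_add_right t2 _)) hwb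
    have m2 := mul_le_mul_of_nonneg_right hw (h.dist_nonneg a x)
    have m3 := mul_le_mul_of_nonneg_right hw (h.dist_nonneg a i)
    linarith

/-- All clients are within weighted distance `α` times the guesses of `U`. -/
def Serves (s : State) (α : ℝ) (U : Finset ℕ) : Prop :=
  ∀ t < 2, ∀ b < s.nat 0 0 0, s.nat 3 b 0 ≠ 0 →
    ∃ i ∈ U, s.real (2 * t + 1) b 0 * s.real (2 * t) b i ≤ α * s.real 4 t 0

/-- `U` is a set of `k` facilities. -/
def Feasible (s : State) (U : Finset ℕ) : Prop :=
  (∀ i ∈ U, i < s.nat 0 0 0 ∧ s.nat 2 i 0 ≠ 0) ∧ U.card = s.nat 1 0 0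

/-- The guess need not be attainable: passing the flag and count tests is enough. The existence of
`k` facilities ensures that padding reaches exactly `k`. -/
theorem solve_sound (s : State) (hM : ∀ t < 2, MetricState s t)
    (hk : ∃ U, Feasible s U)
    (hflag : (solve.run O s).nat 16 0 0 = 0) (hcount : (solve.run O s).nat 17 0 0 ≤ s.nat 1 0 0) :
    Feasible s (opened (solve.run O s)) ∧ Serves s 3 (opened (solve.run O s)) := by
  have hP := prepare_spec (O := O) s
  have er : (prepare.run O s).real = s.real :=
    (LoopProg.frame_run O prepare s).real_eq realWrites_prepare
  have hrun : solve.run O s = construct.run O (prepare.run O s) := LoopProg.run_seq O _ _ s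
  generalize prepare.run O s = s₁ at hP er hrun
  rw [hrun] at hflag hcount ⊢
  obtain ⟨c1, c2, c3, c4, c5, c6⟩ := construct_spec (O := O) s₁
  have e0 := hP.input 0 (by simp)
  have e1 := hP.input 1 (by simp)
  have e2 := hP.input 2 (by simp)
  have e3 := hP.input 3 (by simp)
  have f0 : (construct.run O s₁).nat 0 = s.nat 0 := by
    rw [← e0]
    refine LoopProg.run_nat ?_ s₁
    simp [LoopProg.natWrites, construct, pickClear, pickLeft, pickRight, count, pad]
  generalize construct.run O s₁ = s₂ at hflag hcount c1 c2 c3 c4 c5 c6 f0 ⊢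
  rw [e1, e0, e2] at c6
  rw [e0] at c2
  rw [e2] at c4
  have hP0 : ¬ Picked s₁ 0 := fun h => c1.2 h hflag
  constructor
  · constructor
    · intro i hi
      have := (mem_opened.1 hi).1
      rw [f0] at this
      exact ⟨this, (c4 i hi).elim (fun h => picked_facility hP h) id⟩
    · refine le_antisymm (c3 ▸ hcount) ?_
      rcases c6 with h | h
      · exact c3 ▸ h
      -- Padding ran out of facilities, so the opened set contains every feasible set.
      · obtain ⟨U, hU, hUk⟩ := hk
        rw [← hUk]
        exact Finset.card_le_card fun i hi => h i (hU i hi).1 (hU i hi).2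
  · intro t ht b hb hC
    obtain rfl | rfl : t = 0 ∨ t = 1 := by omega
    · have hg := hP.greedy₁
      rw [GreedyState, e0, e3, er] at hg
      obtain ⟨a, ha, hsa, hw, hd⟩ := hg.cover b hb hC (hP.covered₁ b hb hC)
      obtain ⟨i, hi, hB, hpi⟩ := hP.exists_ball₁ hP0 ha hsa
      exact ⟨i, c2 i hi hpi, (hM 0 (by simp)).three_mul ha hb hi hB hw hd⟩
    · have hg := hP.greedy₂
      rw [GreedyState, e0, e3, er] at hg
      obtain ⟨a, ha, hsa, hw, hd⟩ := hg.cover b hb hC (hP.covered₂ b hb hC)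
      obtain ⟨i, hi, hB, hpi⟩ := hP.exists_ball₂ hP0 ha hsa
      exact ⟨i, c2 i hi hpi, (hM 1 (by simp)).three_mul ha hb hi hB hw hd⟩

/-- The set `U` meets every client's ball in both metrics. So no search for a facility fails, and
weak duality applied to `U` bounds the number of picked facilities. The metric axioms play no role
here. -/
theorem solve_complete (s : State) {U : Finset ℕ} (hU : Feasible s U) (hS : Serves s 1 U) :
    (solve.run O s).nat 16 0 0 = 0 ∧ (solve.run O s).nat 17 0 0 ≤ s.nat 1 0 0 := by
  have hP := prepare_spec (O := O) s
  have er : (prepare.run O s).real = s.real :=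
    (LoopProg.frame_run O prepare s).real_eq realWrites_prepare
  have hrun : solve.run O s = construct.run O (prepare.run O s) := LoopProg.run_seq O _ _ s
  generalize prepare.run O s = s₁ at hP er hrun
  rw [hrun]
  obtain ⟨c1, -, -, -, c5, -⟩ := construct_spec (O := O) s₁
  have e0 := hP.input 0 (by simp)
  have e1 := hP.input 1 (by simp)
  have e3 := hP.input 3 (by simp)
  have hg₁ := hP.greedy₁
  have hg₂ := hP.greedy₂
  rw [GreedyState, e0, e3, er] at hg₁ hg₂
  have hball : ∀ t < 2, ∀ b < s.nat 0 0 0, s.nat 3 b 0 ≠ 0 → ∃ i ∈ U, Ball s t b i := by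
    intro t ht b hb hC
    obtain ⟨i, hi, h⟩ := hS t ht b hb hC
    exact ⟨i, hi, (hU.1 i hi).2, by linarith⟩
  have hW : ∀ {P : ℕ → Prop} {x : ℕ}, Witness (s.nat 0 0 0) P x → (∃ i ∈ U, P i) → x ≠ 0 := by
    rintro P x h ⟨i, hi, hPi⟩
    exact h.ne_zero_iff.2 ⟨i, (hU.1 i hi).1, hPi⟩
  constructor
  · by_contra hne
    rcases c1.1 hne with ⟨c, hc, ⟨h1, h2⟩, h3⟩ | ⟨d, hd, h1, h2⟩
    · rw [e0] at hc
      obtain ⟨i, hi, hB⟩ := hball 0 (by simp) c hc (hg₁.client c hc h1).1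
      exact hW (hP.witness₁ c hc c hc) ⟨i, hi, hB, hB⟩ h3
    · rw [pickedRight] at h2
      split_ifs at h2 with hf
      · rw [e0] at hd
        obtain ⟨i, hi, hB⟩ := hball 1 (by simp) d hd (hg₂.client d hd h1).1
        exact hW (hP.witness₂ d hd d hd) ⟨i, hi, hB, hB⟩ h2
      · have hle := hP.auction.right_le d hd
        exact (hP.auction.edge (s₁.nat 15 d 0 - 1) (by omega) d hd (by omega)).2.2 h2
  · rw [← e1]
    refine c5 ?_
    rw [e1, ← hU.2]
    have hmem : ∀ t a, a ∈ selected t s₁ ↔ a < s.nat 0 0 0 ∧ s₁.nat (t + 20) a 0 ≠ 0 := by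
      intro t a
      simp [selected, e0]
    refine hP.auction.card_le hP.quiet (A := selected 0 s₁) (B := selected 1 s₁)
      (fun a ha => by rw [e0]; exact ((hmem 0 a).1 ha).1)
      (fun a ha => by rw [e0]; exact ((hmem 1 a).1 ha).1)
      (fun c hc d hd hE => (hmem 0 c).2 ⟨e0 ▸ hc, hE.1⟩)
      (Ball s 0) (Ball s 1) ?_ ?_ ?_ ?_ ?_
    · intro a ha b hb i hi h1 h2
      have ha := (hmem 0 a).1 ha
      have hb := (hmem 1 b).1 hb
      exact ⟨ha.2, hb.2, hW (hP.witness a ha.1 b hb.1) ⟨i, hi, h1, h2⟩⟩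
    · intro a ha
      have ha := (hmem 0 a).1 ha
      exact hball 0 (by simp) a ha.1 (hg₁.client a ha.1 ha.2).1
    · intro a ha
      have ha := (hmem 1 a).1 ha
      exact hball 1 (by simp) a ha.1 (hg₂.client a ha.1 ha.2).1
    · intro a ha b hb i hi h1 h2
      have ha := (hmem 0 a).1 ha
      have hb := (hmem 0 b).1 hb
      exact hg₁.indep a ha.1 b hb.1 ha.2 hb.2 ⟨i, (hU.1 i hi).1, h1, h2⟩
    · intro a ha b hb i hi h1 h2
      have ha := (hmem 1 a).1 ha
      have hb := (hmem 1 b).1 hb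
      exact hg₂.indep a ha.1 b hb.1 ha.2 hb.2 ⟨i, (hU.1 i hi).1, h1, h2⟩

/-! ### The memory of an instance -/

section Instance

variable {n : ℕ} (I : SupplierInstance 2 n)

/-- The input arrays have not been changed. -/
def SupplierInstance.Input (s : State) : Prop :=
  ∀ a < 4, s.nat a = I.initialState.nat a ∧ s.real a = I.initialState.real a

/-- The array `4` of reals holds the guess `r`. -/
def Guessed (r : Fin 2 → ℝ≥0) (s : State) : Prop := ∀ t : Fin 2, s.real 4 t 0 = r t

variable {I} {s : State}

theorem SupplierInstance.Input.size (h : I.Input s) : s.nat 0 0 0 = n := by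
  rw [(h 0 (by simp)).1]
  simp [SupplierInstance.initialState]

theorem SupplierInstance.Input.bound (h : I.Input s) : s.nat 1 0 0 = I.k := by
  rw [(h 1 (by simp)).1]
  simp [SupplierInstance.initialState]

theorem SupplierInstance.Input.facility (h : I.Input s) (i : ℕ) :
    s.nat 2 i 0 ≠ 0 ↔ ∃ v ∈ I.F, (v : ℕ) = i := by
  rw [(h 2 (by simp)).1]
  simp [SupplierInstance.initialState]

theorem SupplierInstance.Input.client (h : I.Input s) (i : ℕ) :
    s.nat 3 i 0 ≠ 0 ↔ ∃ v ∈ I.C, (v : ℕ) = i := by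
  rw [(h 3 (by simp)).1]
  simp [SupplierInstance.initialState]

theorem SupplierInstance.initialState_dist (t : Fin 2) (u v : Fin n) :
    I.initialState.real (2 * (t : ℕ)) u v = I.d t u v := by
  simp [SupplierInstance.initialState]
  omega

theorem SupplierInstance.initialState_weight (t : Fin 2) (u : Fin n) :
    I.initialState.real (2 * (t : ℕ) + 1) u 0 = I.w t u := by
  have h1 : (2 * (t : ℕ) + 1) / 2 = t := by omega
  have h2 : (2 * (t : ℕ) + 1) % 2 = 1 := by omega
  simp [SupplierInstance.initialState, h1, h2]
  omega

theorem SupplierInstance.initialState_nonneg (a i j : ℕ) : 0 ≤ I.initialState.real a i j := by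
  simp only [SupplierInstance.initialState]
  split_ifs <;> simp

theorem SupplierInstance.Input.dist (h : I.Input s) (t : Fin 2) (u v : Fin n) :
    s.real (2 * (t : ℕ)) u v = I.d t u v := by
  rw [(h _ (by omega)).2, I.initialState_dist]

theorem SupplierInstance.Input.weight (h : I.Input s) (t : Fin 2) (u : Fin n) :
    s.real (2 * (t : ℕ) + 1) u 0 = I.w t u := by
  rw [(h _ (by omega)).2, I.initialState_weight]

theorem SupplierInstance.Input.metricState (h : I.Input s) (t : ℕ) (ht : t < 2) :
    MetricState s t := by
  have hn := h.size
  refine ⟨?_, ?_, ?_, ?_⟩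
  · intro u hu v hv
    rw [hn] at hu hv
    have h1 := h.dist ⟨t, ht⟩ ⟨u, hu⟩ ⟨v, hv⟩
    have h2 := h.dist ⟨t, ht⟩ ⟨v, hv⟩ ⟨u, hu⟩
    simp only at h1 h2
    rw [h1, h2, I.symm]
  · intro u hu v hv x hx
    rw [hn] at hu hv hx
    have h1 := h.dist ⟨t, ht⟩ ⟨u, hu⟩ ⟨v, hv⟩
    have h2 := h.dist ⟨t, ht⟩ ⟨v, hv⟩ ⟨x, hx⟩
    have h3 := h.dist ⟨t, ht⟩ ⟨u, hu⟩ ⟨x, hx⟩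
    simp only at h1 h2 h3
    rw [h1, h2, h3]
    exact_mod_cast I.triangle ⟨t, ht⟩ ⟨u, hu⟩ ⟨v, hv⟩ ⟨x, hx⟩
  · intro u v
    rw [(h _ (by omega)).2]
    exact I.initialState_nonneg _ _ _
  · intro u
    rw [(h _ (by omega)).2]
    exact I.initialState_nonneg _ _ _

theorem SupplierInstance.Input.feasible_iff (h : I.Input s) (S : Finset (Fin n)) :
    Feasible s (S.map Fin.valEmbedding) ↔ I.IsSolution S := by
  rw [Feasible, SupplierInstance.IsSolution, Finset.card_map, h.bound]
  refine and_congr_left fun _ => ⟨fun hf v hv => ?_, fun hf i hi => ?_⟩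
  · obtain ⟨u, hu, he⟩ := (h.facility _).1 (hf v (Finset.mem_map_of_mem _ hv)).2
    rwa [← Fin.ext he]
  · obtain ⟨v, hv, rfl⟩ := Finset.mem_map.1 hi
    rw [h.size]
    exact ⟨v.2, (h.facility _).2 ⟨v, hf hv, rfl⟩⟩

theorem SupplierInstance.mul_distTo_le_iff {S : Finset (Fin n)} (hS : S.Nonempty) (t : Fin 2)
    (j : Fin n) (x : ℝ≥0) :
    I.w t j * I.distTo t j S ≤ x ↔ ∃ i ∈ S, I.w t j * I.d t j i ≤ x := by
  rw [SupplierInstance.distTo, dif_pos hS]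
  constructor
  · intro h
    obtain ⟨i, hi, he⟩ := Finset.exists_mem_eq_inf' hS (I.d t j)
    exact ⟨i, hi, he ▸ h⟩
  · rintro ⟨i, hi, h⟩
    exact (mul_le_mul_right (Finset.inf'_le _ hi) _).trans h

theorem SupplierInstance.IsSolution.nonempty {S : Finset (Fin n)} (h : I.IsSolution S) :
    S.Nonempty := by
  rw [← Finset.card_pos, h.2]
  exact I.one_le_k

/-- Used with `α = 1` to express that a guess is attainable and with `α = 3` for the guarantee on
the constructed solution. -/
theorem SupplierInstance.Input.serves_iff (h : I.Input s) {r : Fin 2 → ℝ≥0} (hr : Guessed r s)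
    {S : Finset (Fin n)} (hS : I.IsSolution S) (α : ℝ≥0) :
    Serves s α (S.map Fin.valEmbedding) ↔ ∀ t, I.cost S t ≤ α * r t := by
  have key : ∀ (t : Fin 2) (j i : Fin n), s.real (2 * (t : ℕ) + 1) j 0 * s.real (2 * (t : ℕ)) j i ≤
      α * s.real 4 t 0 ↔ I.w t j * I.d t j i ≤ α * r t := by
    intro t j i
    rw [h.weight, h.dist, hr]
    exact_mod_cast Iff.rfl
  simp only [SupplierInstance.cost, Finset.sup_le_iff, I.mul_distTo_le_iff hS.nonempty]
  constructor
  · intro hs t j hj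
    obtain ⟨i, hi, hle⟩ := hs t t.2 j (by rw [h.size]; exact j.2) ((h.client _).2 ⟨j, hj, rfl⟩)
    obtain ⟨v, hv, rfl⟩ := Finset.mem_map.1 hi
    exact ⟨v, hv, (key t j v).1 hle⟩
  · intro hs t ht b hb hC
    obtain ⟨j, hj, rfl⟩ := (h.client b).1 hC
    obtain ⟨i, hi, hle⟩ := hs ⟨t, ht⟩ j hj
    exact ⟨i, Finset.mem_map_of_mem _ hi, (key ⟨t, ht⟩ j i).2 hle⟩

end Instance

/-! ### Search over all guesses -/

/-- Copy the opened facilities to the output. -/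
def copyOpened : LoopProg :=
  .loop 9 0 (.setNat 4 (.var 9) (.const 0) (.arr 16 (.add (.var 9) (.const 1))))

theorem copyOpened_spec (s : State) :
    ∀ i < s.nat 0 0 0, (copyOpened.run O s).nat 4 i 0 = s.nat 16 (i + 1) 0 := by
  refine LoopProg.loop_induction (c := 0)
    (fun m s' => ∀ i < m, s'.nat 4 i 0 = s.nat 16 (i + 1) 0) ?_ ?_ ?_
  · intro i s x h
    simpa using h
  · simp
  · intro i hi s' hF hv h j hj
    have e16 := hF.1 16 (by simp [LoopProg.natWrites])
    simp [LoopProg.run, NExpr.eval, hv, e16]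
    by_cases hji : j = i
    · simp [hji]
    · rw [if_neg hji]
      exact h j (by omega)

/-- The solution is admissible and no worse than the recorded one. -/
def recordGuard : Guard :=
  .conj (.conj (.natLe (.arr 16 (.const 0)) (.const 0)) (.natLe (.var 17) (.var 1)))
    (.neg (.conj (.nonzero (.var 18)) (.neg (.realLe (.query 4) (.get 5 (.const 0) (.const 0))))))

/-- Record a solution if it is admissible and no worse than the recorded one. -/
def record : LoopProg :=
  .ite recordGuard
    (.seq (.setReal 5 (.const 0) (.const 0) (.query 4)) <|
      .seq (.setNat 18 (.const 0) (.const 0) (.const 1)) copyOpened)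
    .skip

/-- Write down the guessed costs. -/
def setGuess : LoopProg :=
  .seq (.setReal 4 (.const 0) (.const 0)
      (.mul (.get 1 (.var 5) (.const 0)) (.get 0 (.var 5) (.var 6))))
    (.setReal 4 (.const 1) (.const 0)
      (.mul (.get 3 (.var 7) (.const 0)) (.get 2 (.var 7) (.var 8))))

/-- Test one guess. -/
def tryGuess : LoopProg := .seq setGuess (.seq solve record)

/-- The whole algorithm: test all guesses. -/
def algorithm : LoopProg := .loop 5 0 (.loop 6 0 (.loop 7 0 (.loop 8 0 tryGuess)))

section Search

variable {n : ℕ} (I : SupplierInstance 2 n) (Ψ : (Fin 2 → ℝ≥0) → ℝ≥0)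

/-- The input is intact and the recorded solution is as good as promised. -/
structure Good (s : State) : Prop where
  input : I.Input s
  output : s.nat 18 0 0 ≠ 0 → ∃ r : Fin 2 → ℝ≥0, s.real 5 0 0 = Ψ r ∧
    I.IsSolution (outputSet n s) ∧ ∀ t, I.cost (outputSet n s) t ≤ 3 * r t

/-- If the guess `r` is attainable, then a solution at most as expensive has been recorded. -/
def Done (r : Fin 2 → ℝ≥0) (s : State) : Prop :=
  (∃ S, I.IsSolution S ∧ ∀ t, I.cost S t ≤ r t) → s.nat 18 0 0 ≠ 0 ∧ s.real 5 0 0 ≤ Ψ r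

/-- The state `s'` is a good one in which everything is done that was done in `s`, and
the guesses in `D` as well. -/
def Improves (D : (Fin 2 → ℝ≥0) → Prop) (s s' : State) : Prop :=
  Good I Ψ s' ∧ (∀ r, Done I Ψ r s → Done I Ψ r s') ∧ ∀ r, D r → Done I Ψ r s'

/-- The guess given by four points. -/
noncomputable def guessOf (a b c d : ℕ) : Fin 2 → ℝ≥0 :=
  ![(I.initialState.real 1 a 0 * I.initialState.real 0 a b).toNNReal,
    (I.initialState.real 3 c 0 * I.initialState.real 2 c d).toNNReal]

variable {I Ψ}

theorem Good.setNat {s : State} (h : Good I Ψ s) {v : ℕ} (hv : 5 ≤ v) (hv' : v ≠ 18) (x : ℕ) :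
    Good I Ψ (s.setNat v 0 0 x) := by
  have e : ∀ a, a ≠ v → (s.setNat v 0 0 x).nat a = s.nat a := by
    intro a ha
    funext i j
    simp [ha]
  constructor
  · intro a ha
    rw [e a (by omega)]
    exact h.input a ha
  · have ho : outputSet n (s.setNat v 0 0 x) = outputSet n s := by
      simp only [outputSet, e 4 (by omega)]
    rw [ho, e 18 hv'.symm]
    exact h.output

theorem done_setNat {r : Fin 2 → ℝ≥0} {s : State} {v : ℕ} (hv : v ≠ 18) (x : ℕ) :
    Done I Ψ r (s.setNat v 0 0 x) ↔ Done I Ψ r s := by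
  simp [Done, hv.symm]

/-- Since `Improves` preserves whatever is already done, the guesses handled in the single rounds
accumulate. -/
theorem improves_loop {v : ℕ} (hv : 5 ≤ v) (hv' : v ≠ 18) {p : LoopProg}
    {D : ℕ → (Fin 2 → ℝ≥0) → Prop} {s₀ : State} (h : Good I Ψ s₀)
    (step : ∀ i < n, ∀ s, (LoopProg.loop v 0 p).Frame s₀ s → s.nat v 0 0 = i → Good I Ψ s →
      Improves I Ψ (D i) s (p.run O s)) :
    Improves I Ψ (fun r => ∃ i < n, D i r) s₀ ((LoopProg.loop v 0 p).run O s₀) := by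
  have hn := h.input.size
  have := LoopProg.loop_induction (O := O) (v := v) (c := 0) (p := p) (s₀ := s₀)
    (fun m s => Improves I Ψ (fun r => ∃ i < m, D i r) s₀ s) ?_ ?_ ?_
  · rwa [hn] at this
  · rintro i s x ⟨h1, h2, h3⟩
    exact ⟨h1.setNat hv hv' x, fun r hr => (done_setNat hv' x).2 (h2 r hr),
      fun r hr => (done_setNat hv' x).2 (h3 r hr)⟩
  · exact ⟨h, fun _ hr => hr, fun r ⟨i, hi, _⟩ => absurd hi (by simp)⟩
  · rintro i hi s hF hvi ⟨h1, h2, h3⟩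
    obtain ⟨g1, g2, g3⟩ := step i (by omega) s hF hvi h1
    refine ⟨g1, fun r hr => g2 r (h2 r hr), ?_⟩
    rintro r ⟨j, hj, hD⟩
    rcases Nat.lt_succ_iff_lt_or_eq.1 hj with hj | rfl
    · exact g2 r (h3 r ⟨j, hj, hD⟩)
    · exact g3 r hD

theorem natWrites_solve {a : ℕ} (h : a < 9 ∨ a = 18) : a ∉ solve.natWrites := by
  have h1 : a ∉ prepare.natWrites := by
    simp only [LoopProg.natWrites, prepare, List.mem_append, not_or]
    refine ⟨?_, ?_, ?_, ?_, ?_, not_mem_natWrites_auction ?_⟩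
    · apply not_mem_natWrites_meet <;> omega
    · apply not_mem_natWrites_meet <;> omega
    · apply not_mem_natWrites_meet <;> omega
    · apply not_mem_natWrites_greedy <;> omega
    · apply not_mem_natWrites_greedy <;> omega
    · simp
      omega
  have h2 : a ∉ construct.natWrites := by
    simp [LoopProg.natWrites, construct, pickClear, pickLeft, pickRight, count, pad]
    omega
  simp only [LoopProg.natWrites, solve, List.mem_append, not_or]
  exact ⟨h1, h2⟩

theorem realWrites_solve : solve.realWrites = [] := by
  simp only [LoopProg.realWrites, solve, realWrites_prepare]
  simp [LoopProg.realWrites, construct, pickClear, pickLeft, pickRight, count, pad]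

/-- Protects the size, the input and the counters `5` to `8` of the four nested loops. -/
theorem natWrites_tryGuess {a : ℕ} (h : a < 9) (h4 : a ≠ 4) : a ∉ tryGuess.natWrites := by
  have h1 := natWrites_solve (.inl h)
  simp [LoopProg.natWrites, tryGuess, setGuess, record, copyOpened, h1]
  omega

/-- The recorded value is `Ψ r`, not the objective of the solution found, so comparing guesses never
requires computing actual costs. -/
theorem record_spec {s₁ s₂ : State} (hI : I.Input s₁) {r : Fin 2 → ℝ≥0} (hr : Guessed r s₁)
    (hn : ∀ a, a < 9 ∨ a = 18 → s₂.nat a = s₁.nat a) (hR : s₂.real = s₁.real)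
    (hG : Good I Ψ s₁)
    (hsound : s₂.nat 16 0 0 = 0 → s₂.nat 17 0 0 ≤ s₁.nat 1 0 0 →
      Feasible s₁ (opened s₂) ∧ Serves s₁ 3 (opened s₂))
    (hcomplete : ∀ U, Feasible s₁ U → Serves s₁ 1 U →
      s₂.nat 16 0 0 = 0 ∧ s₂.nat 17 0 0 ≤ s₁.nat 1 0 0) :
    Improves I Ψ (· = r) s₁ (record.run (valueOracle Ψ) s₂) := by
  have hI₂ : I.Input s₂ := fun a ha => by
    rw [hn a (.inl (by omega)), hR]
    exact hI a ha
  have hq : (RExpr.query 4).eval (valueOracle Ψ) s₂ = Ψ r := by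
    simp only [RExpr.eval, valueOracle, hR]
    congr 2
    funext t
    rw [hr t, Real.toNNReal_coe]
  have hguard : recordGuard.Holds (valueOracle Ψ) s₂ ↔
      (s₂.nat 16 0 0 = 0 ∧ s₂.nat 17 0 0 ≤ s₁.nat 1 0 0) ∧
        (s₁.nat 18 0 0 ≠ 0 → (Ψ r : ℝ) ≤ s₁.real 5 0 0) := by
    simp only [recordGuard, Guard.Holds, hq, hn 18 (.inr rfl), hn 1 (.inl (by simp)),
      NExpr.eval]
    simp [RExpr.eval, NExpr.eval, hR]
  by_cases hc : recordGuard.Holds (valueOracle Ψ) s₂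
  · have hrun : record.run (valueOracle Ψ) s₂ = copyOpened.run (valueOracle Ψ)
        ((s₂.setReal 5 0 0 (Ψ r)).setNat 18 0 0 1) := by
      rw [record, LoopProg.run, if_pos hc]
      simp only [LoopProg.run, NExpr.eval, hq]
    set s₃ := (s₂.setReal 5 0 0 (Ψ r)).setNat 18 0 0 1 with hs₃
    obtain ⟨⟨c1, c2⟩, c3⟩ := hguard.1 hc
    rw [hrun]
    have hcopy := copyOpened_spec (O := valueOracle Ψ) s₃
    have hfr := LoopProg.frame_run (valueOracle Ψ) copyOpened s₃
    generalize copyOpened.run (valueOracle Ψ) s₃ = s₄ at hcopy hfr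
    have w : ∀ a, a ≠ 4 → a ≠ 9 → s₄.nat a = s₃.nat a := fun a h1 h2 =>
      hfr.1 a (by simp [copyOpened, LoopProg.natWrites, h1, h2])
    have wR : s₄.real = s₃.real := hfr.real_eq (by simp [copyOpened, LoopProg.realWrites])
    have f18 : s₄.nat 18 0 0 = 1 := by
      rw [w 18 (by simp) (by simp)]
      simp [hs₃]
    have f5 : s₄.real 5 0 0 = Ψ r := by
      rw [wR]
      simp [hs₃]
    have hI₄ : I.Input s₄ := by
      intro a ha
      by_cases ha4 : a = 4
      · omega
      · rw [w a ha4 (by omega), wR, ← (hI₂ a ha).1, ← (hI₂ a ha).2]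
        constructor
        · funext i j
          simp only [hs₃, State.setNat_nat, State.setReal_nat]
          rw [if_neg (by omega)]
        · funext i j
          simp only [hs₃, State.setNat_real, State.setReal_real]
          rw [if_neg (by omega)]
    have hout : (outputSet n s₄).map Fin.valEmbedding = opened s₂ := by
      ext i
      simp only [Finset.mem_map, outputSet, Finset.mem_filter, Finset.mem_univ, true_and,
        mem_opened, hI₂.size]
      have h3n : s₃.nat 0 0 0 = n := by
        simpa [hs₃] using hI₂.size
      have h16 : ∀ x, s₃.nat 16 x 0 = s₂.nat 16 x 0 := by simp [hs₃]
      constructor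
      · rintro ⟨v, hv, rfl⟩
        rw [hcopy v (by rw [h3n]; exact v.2), h16] at hv
        exact ⟨v.2, hv⟩
      · rintro ⟨hi, hv⟩
        exact ⟨⟨i, hi⟩, by rwa [hcopy i (by rwa [h3n]), h16], rfl⟩
    obtain ⟨hf, hs⟩ := hsound c1 c2
    rw [← hout] at hf hs
    have hsol := (hI.feasible_iff _).1 hf
    refine ⟨⟨hI₄, fun _ => ⟨r, f5, hsol, ?_⟩⟩, ?_, ?_⟩
    · exact (hI.serves_iff hr hsol 3).1 (by simpa using hs)
    · intro r' hd hex
      obtain ⟨h1, h2⟩ := hd hex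
      exact ⟨by simp [f18], f5 ▸ (c3 h1).trans h2⟩
    · rintro r' rfl _
      exact ⟨by simp [f18], f5.le⟩
  · have hrun : record.run (valueOracle Ψ) s₂ = s₂ := by
      rw [record, LoopProg.run, if_neg hc]
      rfl
    rw [hrun]
    have ho : outputSet n s₂ = outputSet n s₁ := by simp only [outputSet, hn 4 (.inl (by simp))]
    have hd : ∀ r', Done I Ψ r' s₂ ↔ Done I Ψ r' s₁ := by
      intro r'
      simp only [Done, hn 18 (.inr rfl), hR]
    refine ⟨⟨hI₂, ?_⟩, fun r' => (hd r').2, ?_⟩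
    · rw [ho, hR, hn 18 (.inr rfl)]
      exact hG.output
    · rintro r' rfl
      rw [hd]
      rintro ⟨S, hS, hle⟩
      have := hcomplete _ ((hI.feasible_iff S).2 hS) (by
        have := (hI.serves_iff hr hS 1).2 (by simpa using hle)
        simpa using this)
      -- An attainable guess passes the test, so it can be rejected only because a better value is
      -- already recorded.
      have h3 : ¬ (s₁.nat 18 0 0 ≠ 0 → (Ψ r' : ℝ) ≤ s₁.real 5 0 0) := fun h => hc (hguard.2 ⟨this, h⟩)
      rw [Classical.not_imp, not_le] at h3
      exact ⟨h3.1, h3.2.le⟩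

theorem tryGuess_spec {s : State} (h : Good I Ψ s) {a b c d : ℕ} (h5 : s.nat 5 0 0 = a)
    (h6 : s.nat 6 0 0 = b) (h7 : s.nat 7 0 0 = c) (h8 : s.nat 8 0 0 = d) :
    Improves I Ψ (· = guessOf I a b c d) s (tryGuess.run (valueOracle Ψ) s) := by
  have hrun : tryGuess.run (valueOracle Ψ) s =
      record.run (valueOracle Ψ) (solve.run (valueOracle Ψ) (setGuess.run (valueOracle Ψ) s)) := by
    rw [tryGuess, LoopProg.run_seq, LoopProg.run_seq]
  have hfr := LoopProg.frame_run (valueOracle Ψ) setGuess s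
  have hg : Guessed (guessOf I a b c d) (setGuess.run (valueOracle Ψ) s) := by
    have e : ∀ k < 4, s.real k = I.initialState.real k := fun k hk => (h.input k hk).2
    intro t
    fin_cases t <;>
      simp [setGuess, LoopProg.run, NExpr.eval, RExpr.eval, h5, h6, h7, h8, guessOf, e,
        mul_nonneg, I.initialState_nonneg]
  rw [hrun]
  generalize setGuess.run (valueOracle Ψ) s = s₁ at hfr hg
  have wN : s₁.nat = s.nat := funext fun k => hfr.1 k (by simp [setGuess, LoopProg.natWrites])
  have wR : ∀ k, k ≠ 4 → s₁.real k = s.real k := fun k hk =>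
    hfr.2 k (by simp [setGuess, LoopProg.realWrites, hk])
  have hI : I.Input s₁ := fun k hk => by
    rw [wN, wR k (by omega)]
    exact h.input k hk
  have hGood : Good I Ψ s₁ := by
    refine ⟨hI, ?_⟩
    rw [wN, wR 5 (by simp), outputSet, wN]
    exact h.output
  have hDone : ∀ r, Done I Ψ r s₁ ↔ Done I Ψ r s := by
    intro r
    simp only [Done, wN, wR 5 (by simp)]
  obtain ⟨F, hF, hFk⟩ := Finset.exists_subset_card_eq I.k_le_card
  have hex : ∃ U, Feasible s₁ U := ⟨_, (hI.feasible_iff F).2 ⟨hF, hFk⟩⟩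
  have hsound := solve_sound (O := valueOracle Ψ) s₁ hI.metricState hex
  have hcomplete := fun U => solve_complete (O := valueOracle Ψ) s₁ (U := U)
  have hnat := fun k (hk : k < 9 ∨ k = 18) =>
    LoopProg.run_nat (O := valueOracle Ψ) (natWrites_solve hk) s₁
  have hreal := (LoopProg.frame_run (valueOracle Ψ) solve s₁).real_eq realWrites_solve
  generalize solve.run (valueOracle Ψ) s₁ = s₂ at hsound hcomplete hnat hreal ⊢
  obtain ⟨h1, h2, h3⟩ := record_spec hI hg hnat hreal hGood hsound hcomplete
  exact ⟨h1, fun r hr => h2 r ((hDone r).2 hr), h3⟩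

theorem algorithm_spec {s : State} (h : Good I Ψ s) :
    Improves I Ψ (fun r => ∃ a < n, ∃ b < n, ∃ c < n, ∃ d < n, r = guessOf I a b c d) s
      (algorithm.run (valueOracle Ψ) s) := by
  have w5 := natWrites_tryGuess (a := 5) (by simp) (by simp)
  have w6 := natWrites_tryGuess (a := 6) (by simp) (by simp)
  have w7 := natWrites_tryGuess (a := 7) (by simp) (by simp)
  refine improves_loop (by simp) (by simp) h fun a _ s₁ _ h5 hG₁ => ?_
  refine improves_loop (by simp) (by simp) hG₁ fun b _ s₂ hF₂ h6 hG₂ => ?_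
  have h5 : s₂.nat 5 0 0 = a := by rw [hF₂.1 5 (by simp [LoopProg.natWrites, w5]), h5]
  refine improves_loop (by simp) (by simp) hG₂ fun c _ s₃ hF₃ h7 hG₃ => ?_
  have h5 : s₃.nat 5 0 0 = a := by rw [hF₃.1 5 (by simp [LoopProg.natWrites, w5]), h5]
  have h6 : s₃.nat 6 0 0 = b := by rw [hF₃.1 6 (by simp [LoopProg.natWrites, w6]), h6]
  refine improves_loop (by simp) (by simp) hG₃ fun d _ s₄ hF₄ h8 hG₄ => ?_
  have h5 : s₄.nat 5 0 0 = a := by rw [hF₄.1 5 (by simp [LoopProg.natWrites, w5]), h5]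
  have h6 : s₄.nat 6 0 0 = b := by rw [hF₄.1 6 (by simp [LoopProg.natWrites, w6]), h6]
  have h7 : s₄.nat 7 0 0 = c := by rw [hF₄.1 7 (by simp [LoopProg.natWrites, w7]), h7]
  exact tryGuess_spec hG₄ h5 h6 h7 h8

theorem good_initialState : Good I Ψ I.initialState :=
  ⟨fun _ _ => ⟨rfl, rfl⟩, fun h => absurd (by simp [SupplierInstance.initialState]) h⟩

/-- Every cost is dominated by a guess, and equal to it unless there are no clients. -/
theorem exists_guess {S : Finset (Fin n)} (hS : I.IsSolution S) (t : Fin 2) :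
    ∃ j i : Fin n, I.cost S t ≤ I.w t j * I.d t j i ∧
      (I.C.Nonempty → I.cost S t = I.w t j * I.d t j i) := by
  rcases I.C.eq_empty_or_nonempty with hC | hC
  -- Without clients the cost is `0`, and any point serves; equality may fail since `d_t(i, i) = 0`
  -- is not assumed.
  · obtain ⟨i, -⟩ := hS.nonempty
    exact ⟨i, i, by simp [SupplierInstance.cost, hC], fun h => absurd hC h.ne_empty⟩
  · obtain ⟨j, -, hj⟩ := Finset.exists_mem_eq_sup I.C hC fun j => I.w t j * I.distTo t j S
    obtain ⟨i, -, hi⟩ := Finset.exists_mem_eq_inf' hS.nonempty (I.d t j)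
    have : I.cost S t = I.w t j * I.d t j i := by
      rw [SupplierInstance.cost, hj, SupplierInstance.distTo, dif_pos hS.nonempty, hi]
    exact ⟨j, i, this.le, fun _ => this⟩

theorem guessOf_eq (a b c d : Fin n) :
    guessOf I a b c d = ![I.w 0 a * I.d 0 a b, I.w 1 c * I.d 1 c d] := by
  have h1 := I.initialState_weight 0 a
  have h2 := I.initialState_dist 0 a b
  have h3 := I.initialState_weight 1 c
  have h4 := I.initialState_dist 1 c d
  simp at h1 h2 h3 h4
  simp only [guessOf, h1, h2, h3, h4, ← NNReal.coe_mul, Real.toNNReal_coe]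

theorem algorithm_isApproxSolution (hΨ : IsHomogeneousAggregator Ψ) :
    I.IsApproxSolution Ψ 3 (outputSet n (algorithm.run (valueOracle Ψ) I.initialState)) := by
  obtain ⟨hG, -, hD⟩ := algorithm_spec (I := I) (Ψ := Ψ) good_initialState
  generalize algorithm.run (valueOracle Ψ) I.initialState = s at hG hD ⊢
  have key : ∀ S, I.IsSolution S → s.nat 18 0 0 ≠ 0 ∧
      (I.C.Nonempty → s.real 5 0 0 ≤ Ψ (I.cost S)) := by
    intro S hS
    obtain ⟨a, b, h1, h2⟩ := exists_guess hS 0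
    obtain ⟨c, d, h3, h4⟩ := exists_guess hS 1
    have hd := hD (guessOf I a b c d) ⟨a, a.2, b, b.2, c, c.2, d, d.2, rfl⟩
    rw [guessOf_eq] at hd
    obtain ⟨g1, g2⟩ := hd ⟨S, hS, by
      intro t
      fin_cases t
      · exact h1
      · exact h3⟩
    refine ⟨g1, fun hC => ?_⟩
    have : I.cost S = ![I.w 0 a * I.d 0 a b, I.w 1 c * I.d 1 c d] := by
      funext t
      fin_cases t
      · exact h2 hC
      · exact h4 hC
    rwa [this]
  obtain ⟨F, hF, hFk⟩ := Finset.exists_subset_card_eq I.k_le_card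
  obtain ⟨r, hr, hsol, hcost⟩ := hG.output (key F ⟨hF, hFk⟩).1
  refine ⟨hsol, fun S' hS' => ?_⟩
  rcases I.C.eq_empty_or_nonempty with hC | hC
  -- Without clients the recorded guess says nothing about the optimum, but all solutions cost the
  -- same.
  · have : I.cost (outputSet n s) = I.cost S' := by
      funext t
      simp [SupplierInstance.cost, hC]
    rw [this]
    exact le_mul_of_one_le_left zero_le (by norm_num)
  · have h1 : Ψ r ≤ Ψ (I.cost S') := by
      have := (key S' hS').2 hC
      rw [hr] at this
      exact_mod_cast this
    calc Ψ (I.cost (outputSet n s)) ≤ Ψ ((3 : ℝ≥0) • r) := hΨ.monotone fun t => by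
          simpa using hcost t
      _ = 3 * Ψ r := hΨ.homogeneous 3 r
      _ ≤ 3 * Ψ (I.cost S') := mul_le_mul_right h1 3

theorem wellFormed_algorithm : algorithm.WellFormed := by
  simp [algorithm, tryGuess, setGuess, solve, prepare, meet, meetRow, meetSearch, greedy,
    greedyClear, greedyRound, greedyBest, greedyMark, auction, auctionClear, bidRound, bidStep,
    bidBest, assign, construct, pickClear, pickLeft, pickRight, count, pad, record, copyOpened,
    LoopProg.WellFormed, LoopProg.natWrites]

theorem size_not_mem_natWrites_algorithm : 0 ∉ algorithm.natWrites := by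
  have := natWrites_tryGuess (a := 0) (by simp) (by simp)
  simp [algorithm, LoopProg.natWrites, this]

end Search

end AggregateSupplier

theorem mainTheorem2 :
    ∃ (p : RealRAM.Prog) (q : Polynomial ℕ),
      ∀ Ψ : (Fin 2 → ℝ≥0) → ℝ≥0, AggregateSupplier.IsHomogeneousAggregator Ψ →
        ∀ (n : ℕ) (I : AggregateSupplier.SupplierInstance 2 n),
          ∃ (s : RealRAM.State) (t : ℕ),
            RealRAM.Exec (AggregateSupplier.valueOracle Ψ) p I.initialState s t ∧
              t ≤ q.eval n ∧
              I.IsApproxSolution Ψ 3 (AggregateSupplier.outputSet n s) := by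
  refine ⟨AggregateSupplier.algorithm.compile, AggregateSupplier.algorithm.time, ?_⟩
  intro Ψ hΨ n I
  obtain ⟨t, he, ht⟩ := RealRAM.LoopProg.exec_run (AggregateSupplier.valueOracle Ψ)
    AggregateSupplier.wellFormed_algorithm AggregateSupplier.size_not_mem_natWrites_algorithm
    I.initialState
  rw [(AggregateSupplier.good_initialState (I := I) (Ψ := Ψ)).input.size] at ht
  exact ⟨_, t, he, ht, AggregateSupplier.algorithm_isApproxSolution hΨ⟩
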